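/- For $k\ge 1$ let $P_k=\mathbb F_2[x_1,\dots,x_k]$ be the polynomial algebra with each $x_j$ of degree $1$, with the action of the mod-2 Steenrod algebra $\mathcal A$ given by the linear operations $Sq^i$ ($i\ge 0$) with $Sq^0(1)=1$, $Sq^i(1)=0$ for $i>0$, $Sq^0(x_j)=x_j$, $Sq^1(x_j)=x_j^2$, $Sq^i(x_j)=0$ for $i>1$, and the Cartan formula $Sq^n(fg)=\sum_{i=0}^n Sq^i(f)\,Sq^{n-i}(g)$. Let $\mathcal A^+P_k$ be the set of all finite sums of elements $Sq^i(f)$ with $i>0$ and $f\in P_k$, and let $QP_k=P_k/\mathcal A^+P_k=\mathbb F_2\otimes_{\mathcal A}P_k$. For $n\ge 0$ let $(QP_k)_n$ be the subspace of $QP_k$ of all classes represented by homogeneous polynomials of degree $n$; it is a finite-dimensional $\mathbb F_2$-vector space. Theorem. Let $k$ be an integer and let $d_1,\dots,d_{k-1}$ be positive integers with $d_1>d_2>\dots>d_{k-2}\ge d_{k-1}$. Put $$n=\sum_{i=1}^{k-1}(2^{d_i}-1),\qquad m=\sum_{i=1}^{k-2}(2^{d_i-d_{k-1}}-1).$$ If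 $d_{k-1}\ge k-1\ge 3$, then $$\dim_{\mathbb F_2}(QP_k)_n=(2^k-1)\,\dim_{\mathbb F_2}(QP_{k-1})_m .$$ -/

import Mathlib

/-- The polynomial algebra `P_k = 𝔽₂[x₁, …, x_k]`, each variable having degree `1`. -/
abbrev PolyAlg (k : ℕ) : Type := MvPolynomial (Fin k) (ZMod 2)

/-- The total Steenrod square `f ↦ ∑ i, Sq^i(f) t^i`, the algebra homomorphism `P_k → P_k[t]`
with `x_j ↦ x_j + x_j² t`. -/
noncomputable def totalSq (k : ℕ) : PolyAlg k →ₐ[ZMod 2] Polynomial (PolyAlg k) :=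
  MvPolynomial.aeval fun j =>
    Polynomial.C (MvPolynomial.X j) + Polynomial.C (MvPolynomial.X j ^ 2) * Polynomial.X

/-- The action on `P_k` of the Steenrod square `Sq^i`: the coefficient of `t^i` in the total
square. By `Sq_X` and `Sq_mul` below it has the prescribed values on the variables and satisfies
the Cartan formula; with linearity and the values on `1` this determines it. -/
noncomputable def Sq {k : ℕ} (i : ℕ) : PolyAlg k →ₗ[ZMod 2] PolyAlg k :=
  ((Polynomial.lcoeff (PolyAlg k) i).restrictScalars (ZMod 2)).comp (totalSq k).toLinearMap

theorem Sq_apply {k : ℕ} (i : ℕ) (f : PolyAlg k) : Sq i f = (totalSq k f).coeff i := rfl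

theorem Sq_X {k : ℕ} (i : ℕ) (j : Fin k) :
    Sq i (MvPolynomial.X j : PolyAlg k) =
      if i = 0 then MvPolynomial.X j else if i = 1 then MvPolynomial.X j ^ 2 else 0 := by
  rw [Sq_apply, totalSq, MvPolynomial.aeval_X, Polynomial.coeff_add, Polynomial.coeff_C,
    Polynomial.coeff_C_mul, Polynomial.coeff_X]
  rcases i with _ | _ | i <;> simp

theorem Sq_one {k : ℕ} (i : ℕ) : Sq i (1 : PolyAlg k) = if i = 0 then 1 else 0 := by
  rw [Sq_apply, map_one, Polynomial.coeff_one]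

/-- The Cartan formula. -/
theorem Sq_mul {k : ℕ} (n : ℕ) (f g : PolyAlg k) :
    Sq n (f * g) = ∑ i ∈ Finset.range (n + 1), Sq i f * Sq (n - i) g := by
  simp only [Sq_apply, map_mul, Polynomial.coeff_mul]
  exact Finset.Nat.sum_antidiagonal_eq_sum_range_succ
    (fun a b => (totalSq k f).coeff a * (totalSq k g).coeff b) n

/-- The space `𝒜⁺P_k` of hit polynomials: all finite sums of elements `Sq^i(f)` with `i > 0` and
`f ∈ P_k`. As the augmentation ideal `𝒜⁺` of the Steenrod algebra is generated by the `Sq^i` with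
`i > 0`, this is the action of `𝒜⁺` on `P_k`. -/
noncomputable def hit (k : ℕ) : Submodule (ZMod 2) (PolyAlg k) :=
  ⨆ (i : ℕ) (_ : 0 < i), LinearMap.range (Sq (k := k) i)

/-- The space of indecomposables `QP_k = P_k / 𝒜⁺P_k = 𝔽₂ ⊗_𝒜 P_k`. -/
abbrev QP (k : ℕ) : Type := PolyAlg k ⧸ hit k

/-- `(QP_k)_n`: the subspace of `QP_k` of all classes represented by homogeneous polynomials of
degree `n`. -/
noncomputable def QPdeg (k n : ℕ) : Submodule (ZMod 2) (QP k) :=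
  (MvPolynomial.homogeneousSubmodule (Fin k) (ZMod 2) n).map (hit k).mkQ

/-- `(QP_k)_n` is finite dimensional, so that `Module.finrank` is its dimension. -/
instance QPdeg_finite (k n : ℕ) : Module.Finite (ZMod 2) (QPdeg k n) := by
  have hf : {e : Fin k →₀ ℕ | e.degree = n}.Finite := by
    refine (Set.finite_Iic (Finsupp.equivFunOnFinite.symm fun _ : Fin k => n)).subset ?_
    intro e he i
    have he' : e.degree = n := he
    simpa [he'] using Finsupp.le_degree i e
  have hfin := FiniteDimensional.span_of_finite (ZMod 2)
    (hf.image fun e => (MvPolynomial.monomial e (1 : ZMod 2) : PolyAlg k))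
  have hle : MvPolynomial.homogeneousSubmodule (Fin k) (ZMod 2) n ≤
      Submodule.span (ZMod 2) ((fun e => (MvPolynomial.monomial e (1 : ZMod 2) : PolyAlg k)) ''
        {e : Fin k →₀ ℕ | e.degree = n}) := by
    intro f hfn
    rw [f.as_sum]
    refine Submodule.sum_mem _ fun e he => ?_
    have hmon : MvPolynomial.monomial e (f.coeff e) =
        f.coeff e • (MvPolynomial.monomial e (1 : ZMod 2) : PolyAlg k) := by
      rw [MvPolynomial.smul_monomial, smul_eq_mul, mul_one]
    rw [hmon]
    refine Submodule.smul_mem _ _ (Submodule.subset_span ⟨e, ?_, rfl⟩)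
    have hdeg := (MvPolynomial.mem_homogeneousSubmodule n f).1 hfn (MvPolynomial.mem_support_iff.1 he)
    have hw : e.degree = Finsupp.weight (1 : Fin k → ℕ) e :=
      DFunLike.congr_fun Finsupp.degree_eq_weight_one e
    exact hw.trans hdeg
  have h : Module.Finite (ZMod 2) (MvPolynomial.homogeneousSubmodule (Fin k) (ZMod 2) n) :=
    Submodule.finiteDimensional_of_le hle
  exact Module.Finite.map _ _

/-!
For `j ≤ k = q + 1` let `lift j y = x₁ ⋯ x̂_j ⋯ x_k · y²`. In the degrees in question a monomial
with fewer than `q` odd exponents is hit, so modulo hit polynomials every polynomial of degree `n`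
is a sum of `d`-fold lifts of polynomials of degree `m`, and a `d`-fold lift depends only on the
set `S` of the omitted indices; write `setLift d S` for it.

For a nonempty `L`, restriction to the hyperplane `∑_{j ∈ L} x_j = 0` followed by `d` applications
of Kameko's map sends `setLift d S y` to the restriction of `y` if `S ⊆ L`, and to `0` otherwise.
These maps detect hit polynomials: if they all send `∑_S setLift d S (y_S)` to hit polynomials, then
`∑_{S ⊆ L} y_S` is, modulo hit polynomials, divisible by `∑_{j ∈ L} x_j` for all `L`, and Möbius
inversion over the subsets reduces the claim to the relations
`∑_j setLift d (T ∪ {j}) (x_j u) ≡ 0`. If `d = q` no lift omits all indices; the one missing from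
these relations is then replaced by an abstract linear map. Hence `(QP_k)_n` is isomorphic to a
product of copies of `(QP_{k-1})_m`, one for each of the `2^k - 1` nonempty sets `L`.
-/

namespace HitProblem

open MvPolynomial

section DegreeSupport

variable {k : ℕ}

/-- The space of polynomials in `P_k` all of whose monomials have their degree in `A`. -/
noncomputable def degreeIn (k : ℕ) (A : Set ℕ) : Submodule (ZMod 2) (PolyAlg k) :=
  restrictSupport (ZMod 2) {e | e.degree ∈ A}

theorem degreeIn_mono {A B : Set ℕ} (h : A ⊆ B) : degreeIn k A ≤ degreeIn k B :=
  restrictSupport_mono _ fun _ he => h he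

theorem degreeIn_univ : degreeIn k Set.univ = ⊤ :=
  restrictSupport_univ _

theorem degreeIn_singleton (n : ℕ) :
    degreeIn k {n} = homogeneousSubmodule (Fin k) (ZMod 2) n :=
  (homogeneousSubmodule_eq_finsupp_supported _ _ n).symm

theorem monomial_mem_degreeIn {A : Set ℕ} {e : Fin k →₀ ℕ} (he : e.degree ∈ A) (c : ZMod 2) :
    monomial e c ∈ degreeIn k A :=
  (monomial_mem_restrictSupport _).2 (Or.inl he)

theorem one_mem_degreeIn {A : Set ℕ} (h : 0 ∈ A) : (1 : PolyAlg k) ∈ degreeIn k A :=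
  monomial_mem_degreeIn (e := 0) (by simpa using h) 1

theorem X_pow_mem_degreeIn {A : Set ℕ} {a : ℕ} (ha : a ∈ A) (j : Fin k) :
    (X j ^ a : PolyAlg k) ∈ degreeIn k A := by
  rw [X_pow_eq_monomial]
  exact monomial_mem_degreeIn (by simpa using ha) 1

theorem X_mem_degreeIn (j : Fin k) : (X j : PolyAlg k) ∈ degreeIn k {1} :=
  monomial_mem_degreeIn (by simp) 1

theorem mul_mem_degreeIn {A B C : Set ℕ} {f g : PolyAlg k} (hf : f ∈ degreeIn k A)
    (hg : g ∈ degreeIn k B) (h : ∀ a ∈ A, ∀ b ∈ B, a + b ∈ C) : f * g ∈ degreeIn k C := by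
  have hfg := Submodule.mul_mem_mul hf hg
  rw [degreeIn, degreeIn, ← restrictSupport_add] at hfg
  refine restrictSupport_mono _ ?_ hfg
  rintro _ ⟨a, ha, b, hb, rfl⟩
  simpa using h _ ha _ hb

theorem degreeIn_le {A : Set ℕ} {W : Submodule (ZMod 2) (PolyAlg k)}
    (h : ∀ e : Fin k →₀ ℕ, e.degree ∈ A → monomial e 1 ∈ W) : degreeIn k A ≤ W := by
  rw [degreeIn, restrictSupport_eq_span, Submodule.span_le]
  rintro _ ⟨e, he, rfl⟩
  exact h e he

theorem map_mem_of_monomial {V : Type*} [AddCommGroup V] [Module (ZMod 2) V]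
    (φ : PolyAlg k →ₗ[ZMod 2] V) {W : Submodule (ZMod 2) V}
    (h : ∀ e, φ (monomial e 1) ∈ W) (f : PolyAlg k) : φ f ∈ W := by
  have hle : degreeIn k Set.univ ≤ W.comap φ := degreeIn_le fun e _ => h e
  rw [degreeIn_univ] at hle
  exact hle trivial

theorem homogeneousComponent_of_mem_degreeIn {n : ℕ} {f : PolyAlg k} (hf : f ∈ degreeIn k {n}) :
    homogeneousComponent n f = f := by
  rw [degreeIn_singleton] at hf
  rw [homogeneousComponent_of_mem hf, if_pos rfl]

theorem homogeneousComponent_eq_zero_of_mem_degreeIn {n : ℕ} {A : Set ℕ} {f : PolyAlg k}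
    (hf : f ∈ degreeIn k A) (hn : n ∉ A) : homogeneousComponent n f = 0 :=
  homogeneousComponent_eq_zero' _ _ fun _ he h => hn (h ▸ hf he)

theorem sub_homogeneousComponent_mem_degreeIn (n : ℕ) (f : PolyAlg k) :
    f - homogeneousComponent n f ∈ degreeIn k {n}ᶜ := by
  refine (mem_restrictSupport_iff _).2 fun e he h => mem_support_iff.1 he ?_
  rw [Set.mem_singleton_iff] at h
  rw [coeff_sub, coeff_homogeneousComponent, if_pos h, sub_self]

theorem exponent_induction {p : (Fin k →₀ ℕ) → Prop} (zero : p 0)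
    (single_add : ∀ j e, p e → p (Finsupp.single j 1 + e)) (e : Fin k →₀ ℕ) : p e := by
  obtain ⟨s, rfl⟩ := Multiset.toFinsupp.surjective e
  induction s using Multiset.induction_on with
  | empty => simpa only [map_zero] using zero
  | cons j s ih =>
    rw [← Multiset.singleton_add, map_add, Multiset.toFinsupp_singleton]
    exact single_add j _ ih

theorem monomial_single_one_add (j : Fin k) (e : Fin k →₀ ℕ) :
    (monomial (Finsupp.single j 1 + e) 1 : PolyAlg k) = X j * monomial e 1 := by
  rw [monomial_single_add, pow_one]

end DegreeSupport

section SteenrodSquares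

variable {k : ℕ}

theorem Sq_monomial_mem_degreeIn (i : ℕ) (e : Fin k →₀ ℕ) :
    Sq i (monomial e 1) ∈ degreeIn k {e.degree + i} := by
  induction e using exponent_induction generalizing i with
  | zero =>
    rw [show (monomial 0 1 : PolyAlg k) = 1 from rfl, Sq_one]
    split_ifs with hi
    · exact one_mem_degreeIn (by simp [hi])
    · exact zero_mem _
  | single_add j e ih =>
    rw [monomial_single_one_add, Sq_mul, map_add, Finsupp.degree_single]
    refine Submodule.sum_mem _ fun a ha => ?_
    have hX : Sq a (X j : PolyAlg k) ∈ degreeIn k {1 + a} := by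
      rw [Sq_X]
      split_ifs with h0 h1
      · exact degreeIn_mono (by simp [h0]) (X_mem_degreeIn j)
      · exact X_pow_mem_degreeIn (by simp [h1]) j
      · exact zero_mem _
    refine mul_mem_degreeIn hX (ih (i - a)) ?_
    rintro _ rfl _ rfl
    have := Finset.mem_range_succ_iff.1 ha
    rw [Set.mem_singleton_iff]
    omega

theorem Sq_zero (f : PolyAlg k) : Sq 0 f = f := by
  have h : ((Polynomial.aeval (0 : PolyAlg k)).restrictScalars (ZMod 2)).comp (totalSq k) =
      AlgHom.id _ _ := by
    ext j
    simp [totalSq]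
  rw [Sq_apply, Polynomial.coeff_zero_eq_aeval_zero]
  exact DFunLike.congr_fun h f

/-- The sum `∑ i, Sq^i` of all Steenrod squares, that is, the total square at `t = 1`. -/
noncomputable def sqSum (k : ℕ) : PolyAlg k →ₐ[ZMod 2] PolyAlg k :=
  ((Polynomial.aeval (1 : PolyAlg k)).restrictScalars (ZMod 2)).comp (totalSq k)

@[simp] theorem sqSum_X (j : Fin k) : sqSum k (X j) = X j + X j ^ 2 := by
  simp [sqSum, totalSq]

theorem sqSum_eq_sum_range (f : PolyAlg k) :
    sqSum k f = ∑ i ∈ Finset.range ((totalSq k f).natDegree + 1), Sq i f := by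
  simp [sqSum, Polynomial.eval_eq_sum_range, Sq_apply]

theorem sqSum_sub_self (f : PolyAlg k) :
    sqSum k f - f = ∑ i ∈ Finset.range (totalSq k f).natDegree, Sq (i + 1) f := by
  rw [sqSum_eq_sum_range, Finset.sum_range_succ', Sq_zero, add_sub_cancel_right]

theorem sqSum_monomial_sub_self_mem_degreeIn (e : Fin k →₀ ℕ) :
    sqSum k (monomial e 1) - monomial e 1 ∈ degreeIn k (Set.Ioi e.degree) := by
  rw [sqSum_sub_self]
  exact Submodule.sum_mem _ fun i _ => degreeIn_mono (by simp) (Sq_monomial_mem_degreeIn (i + 1) e)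

theorem monomial_one_sq (e : Fin k →₀ ℕ) :
    (monomial e 1 : PolyAlg k) ^ 2 = monomial (2 • e) 1 := by
  rw [monomial_pow, one_pow]

theorem sqSum_monomial_sub_sq_mem_degreeIn (e : Fin k →₀ ℕ) :
    sqSum k (monomial e 1) - monomial e 1 ^ 2 ∈ degreeIn k (Set.Iio (2 * e.degree)) := by
  induction e using exponent_induction with
  | zero =>
    rw [show (monomial 0 1 : PolyAlg k) = 1 from rfl, map_one, one_pow, sub_self]
    exact zero_mem _
  | single_add j e ih =>
    have hS : sqSum k (monomial e 1) ∈ degreeIn k (Set.Iic (2 * e.degree)) := by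
      rw [← sub_add_cancel (sqSum k (monomial e 1)) (monomial e 1 ^ 2), monomial_one_sq]
      exact add_mem (degreeIn_mono Set.Iio_subset_Iic_self (monomial_one_sq e ▸ ih))
        (monomial_mem_degreeIn (by simp) 1)
    have hsplit : (X j + X j ^ 2) * sqSum k (monomial e 1) - (X j * monomial e 1) ^ 2 =
        X j * sqSum k (monomial e 1) +
          X j ^ 2 * (sqSum k (monomial e 1) - monomial e 1 ^ 2) := by ring
    rw [monomial_single_one_add, map_mul, sqSum_X, map_add, Finsupp.degree_single, hsplit]
    refine add_mem (mul_mem_degreeIn (X_mem_degreeIn j) hS ?_)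
      (mul_mem_degreeIn (X_pow_mem_degreeIn (A := {2}) rfl j) ih ?_)
    all_goals
      simp only [Set.mem_singleton_iff, Set.mem_Iio, Set.mem_Iic]
      intros; omega

theorem map_mem_of_sqSum {V : Type*} [AddCommGroup V] [Module (ZMod 2) V]
    (φ : PolyAlg k →ₗ[ZMod 2] V) {W : Submodule (ZMod 2) V} (n : ℕ)
    (hdeg : ∀ e : Fin k →₀ ℕ, e.degree ≠ n → φ (monomial e 1) ∈ W)
    (hsq : ∀ g, φ (sqSum k g) ∈ W) (f : PolyAlg k) : φ f ∈ W := by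
  refine map_mem_of_monomial φ (fun e => ?_) f
  by_cases he : e.degree = n
  · have hle : degreeIn k (Set.Ioi e.degree) ≤ W.comap φ :=
      degreeIn_le fun c hc => hdeg c (ne_of_gt (he ▸ hc))
    have htail : φ (sqSum k (monomial e 1) - monomial e 1) ∈ W :=
      hle (sqSum_monomial_sub_self_mem_degreeIn e)
    rw [map_sub] at htail
    simpa only [sub_sub_cancel] using sub_mem (hsq (monomial e 1)) htail
  · exact hdeg e he

end SteenrodSquares

section HitComponent

variable {k : ℕ}

/-- The polynomials in `P_k` whose homogeneous component of degree `N` is hit; the quotient by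
this subspace is `(QP_k)_N`, see `quotHitAtEquiv`. -/
noncomputable def hitAt (k N : ℕ) : Submodule (ZMod 2) (PolyAlg k) :=
  (hit k).comap (homogeneousComponent N)

theorem Sq_mem_hit {i : ℕ} (hi : 0 < i) (f : PolyAlg k) : Sq i f ∈ hit k :=
  Submodule.mem_iSup_of_mem i (Submodule.mem_iSup_of_mem hi ⟨f, rfl⟩)

theorem hit_le {W : Submodule (ZMod 2) (PolyAlg k)}
    (h : ∀ i > 0, ∀ e, Sq i (monomial e 1) ∈ W) : hit k ≤ W :=
  iSup₂_le fun i hi => LinearMap.range_le_iff_comap.2 <|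
    Submodule.eq_top_iff'.2 (map_mem_of_monomial (Sq i) (h i hi))

theorem hit_le_hitAt (N : ℕ) : hit k ≤ hitAt k N := by
  refine hit_le fun i hi e => ?_
  rw [hitAt, Submodule.mem_comap]
  by_cases hN : e.degree + i = N
  · rw [homogeneousComponent_of_mem_degreeIn (hN ▸ Sq_monomial_mem_degreeIn i e)]
    exact Sq_mem_hit hi _
  · rw [homogeneousComponent_eq_zero_of_mem_degreeIn (Sq_monomial_mem_degreeIn i e)
      (Ne.symm hN)]
    exact zero_mem _

theorem sqSum_sub_mem_hitAt (N : ℕ) (f : PolyAlg k) : sqSum k f - f ∈ hitAt k N := by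
  refine hit_le_hitAt N ?_
  rw [sqSum_sub_self]
  exact Submodule.sum_mem _ fun i _ => Sq_mem_hit i.succ_pos f

theorem degreeIn_le_hitAt {N : ℕ} {A : Set ℕ} (h : N ∉ A) : degreeIn k A ≤ hitAt k N := by
  intro f hf
  rw [hitAt, Submodule.mem_comap, homogeneousComponent_eq_zero_of_mem_degreeIn hf h]
  exact zero_mem _

theorem mem_hitAt_of_ne {n N : ℕ} {f : PolyAlg k} (hf : f ∈ degreeIn k {n}) (h : n ≠ N) :
    f ∈ hitAt k N :=
  degreeIn_le_hitAt (by simpa using h.symm) hf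

theorem monomial_mem_hitAt_of_degree_ne {N : ℕ} {e : Fin k →₀ ℕ} (h : e.degree ≠ N) :
    (monomial e 1 : PolyAlg k) ∈ hitAt k N :=
  mem_hitAt_of_ne (n := e.degree) (monomial_mem_degreeIn (Set.mem_singleton _) 1) h

theorem homogeneousComponent_sqSum_sub_self {i : ℕ} (hi : 0 < i) (e : Fin k →₀ ℕ) :
    homogeneousComponent (e.degree + i) (sqSum k (monomial e 1) - monomial e 1) =
      Sq i (monomial e 1) := by
  rw [map_sub, homogeneousComponent_eq_zero_of_mem_degreeIn
    (monomial_mem_degreeIn (A := {e.degree}) rfl 1) (by simpa using hi.ne'), sub_zero,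
    sqSum_eq_sum_range, map_sum, Finset.sum_eq_single i]
  · exact homogeneousComponent_of_mem_degreeIn (Sq_monomial_mem_degreeIn i e)
  · intro j _ hj
    exact homogeneousComponent_eq_zero_of_mem_degreeIn (Sq_monomial_mem_degreeIn j e)
      (by simpa using hj.symm)
  · intro h
    rw [Finset.mem_range_succ_iff, not_le] at h
    rw [Sq_apply, Polynomial.coeff_eq_zero_of_natDegree_lt h, map_zero]

theorem map_mem_of_mem_hitAt {V : Type*} [AddCommGroup V] [Module (ZMod 2) V]
    (φ : PolyAlg k →ₗ[ZMod 2] V) {W : Submodule (ZMod 2) V} {N : ℕ}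
    (hsq : ∀ g, φ (sqSum k g - g) ∈ W)
    (hdeg : ∀ e : Fin k →₀ ℕ, e.degree ≠ N → φ (monomial e 1) ∈ W)
    {f : PolyAlg k} (hf : f ∈ hitAt k N) : φ f ∈ W := by
  have hle : degreeIn k {N}ᶜ ≤ W.comap φ := degreeIn_le fun e he => hdeg e he
  have hcomp (f : PolyAlg k) : homogeneousComponent N f ∈ W.comap φ ↔ f ∈ W.comap φ := by
    rw [← Submodule.add_mem_iff_right _ (hle (sub_homogeneousComponent_mem_degreeIn N f)),
      sub_add_cancel]
  suffices h : hit k ≤ W.comap φ from (hcomp f).1 (h hf)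
  refine hit_le fun i hi e => ?_
  by_cases hN : e.degree + i = N
  · rw [← homogeneousComponent_sqSum_sub_self hi, hN, hcomp]
    exact hsq _
  · exact hle (degreeIn_mono (by simpa using Ne.symm hN) (Sq_monomial_mem_degreeIn i e))

theorem range_homogeneousComponent (k N : ℕ) :
    LinearMap.range (homogeneousComponent N) = homogeneousSubmodule (Fin k) (ZMod 2) N := by
  refine le_antisymm ?_ fun f hf => ⟨f, ?_⟩
  · rintro _ ⟨f, rfl⟩
    exact homogeneousComponent_mem N f
  · rw [homogeneousComponent_of_mem hf, if_pos rfl]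

/-- `(QP_k)_N` as a quotient of `P_k`. -/
noncomputable def quotHitAtEquiv (k N : ℕ) : (PolyAlg k ⧸ hitAt k N) ≃ₗ[ZMod 2] QPdeg k N :=
  (Submodule.quotEquivOfEq _ _
      (by rw [LinearMap.ker_comp, Submodule.ker_mkQ, hitAt])).trans <|
    ((hit k).mkQ.comp (homogeneousComponent N)).quotKerEquivRange.trans <|
      LinearEquiv.ofEq _ _ (by rw [LinearMap.range_comp, range_homogeneousComponent, QPdeg])

end HitComponent

section BinaryWeight

/-- The number `α(n)` of digits `1` in the binary expansion of `n`. -/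
def binaryWeight (n : ℕ) : ℕ := (Nat.digits 2 n).sum

theorem binaryWeight_two_mul (n : ℕ) : binaryWeight (2 * n) = binaryWeight n := by
  rcases n.eq_zero_or_pos with rfl | hn
  · rfl
  · rw [binaryWeight, Nat.digits_base_mul one_lt_two hn, List.sum_cons, zero_add, binaryWeight]

theorem binaryWeight_two_mul_add_one (n : ℕ) :
    binaryWeight (2 * n + 1) = binaryWeight n + 1 := by
  rw [binaryWeight, Nat.digits_def' one_lt_two (Nat.succ_pos _), List.sum_cons, binaryWeight,
    show (2 * n + 1) % 2 = 1 by omega, show (2 * n + 1) / 2 = n by omega, add_comm]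

theorem binaryWeight_two_pow_mul (a n : ℕ) : binaryWeight (2 ^ a * n) = binaryWeight n := by
  induction a with
  | zero => rw [pow_zero, one_mul]
  | succ a ih => rw [pow_succ', mul_assoc, binaryWeight_two_mul, ih]

theorem binaryWeight_two_pow (a : ℕ) : binaryWeight (2 ^ a) = 1 := by
  simpa [binaryWeight] using binaryWeight_two_pow_mul a 1

theorem binaryWeight_le_self (n : ℕ) : binaryWeight n ≤ n :=
  Nat.digit_sum_le 2 n

theorem padicValNat_two_factorial (n : ℕ) :
    padicValNat 2 n.factorial = n - binaryWeight n := by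
  rw [binaryWeight, ← sub_one_mul_padicValNat_factorial, Nat.add_one_sub_one, one_mul]

theorem binaryWeight_add_le (m n : ℕ) :
    binaryWeight (m + n) ≤ binaryWeight m + binaryWeight n := by
  have hval : padicValNat 2 (m.factorial * n.factorial) ≤ padicValNat 2 (m + n).factorial :=
    (padicValNat_dvd_iff_le (Nat.factorial_ne_zero _)).1
      (pow_padicValNat_dvd.trans (Nat.factorial_mul_factorial_dvd_factorial_add m n))
  rw [padicValNat.mul (Nat.factorial_ne_zero _) (Nat.factorial_ne_zero _),
    padicValNat_two_factorial, padicValNat_two_factorial, padicValNat_two_factorial] at hval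
  have := binaryWeight_le_self m
  have := binaryWeight_le_self n
  have := binaryWeight_le_self (m + n)
  omega

theorem binaryWeight_sum_two_pow (s : Finset ℕ) : binaryWeight (∑ a ∈ s, 2 ^ a) = s.card := by
  induction s using Finset.induction_on_min with
  | empty => rfl
  | insert a s ha ih =>
    have hs : a ∉ s := fun h => lt_irrefl a (ha a h)
    obtain ⟨y, hy⟩ : 2 ^ (a + 1) ∣ ∑ b ∈ s, 2 ^ b :=
      Finset.dvd_sum fun b hb => pow_dvd_pow 2 (ha b hb)
    rw [hy, binaryWeight_two_pow_mul] at ih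
    rw [Finset.sum_insert hs, hy, Finset.card_insert_of_notMem hs, ← ih,
      show 2 ^ a + 2 ^ (a + 1) * y = 2 ^ a * (2 * y + 1) by ring, binaryWeight_two_pow_mul,
      binaryWeight_two_mul_add_one]

theorem binaryWeight_two_pow_mul_sub_one (t : ℕ) {n : ℕ} (hn : 0 < n) :
    binaryWeight (2 ^ t * n - 1) = binaryWeight (n - 1) + t := by
  induction t with
  | zero => rw [pow_zero, one_mul, add_zero]
  | succ t ih =>
    have hpos : 0 < 2 ^ t * n := by positivity
    rw [pow_succ', mul_assoc, show 2 * (2 ^ t * n) - 1 = 2 * (2 ^ t * n - 1) + 1 by omega,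
      binaryWeight_two_mul_add_one, ih, add_assoc]

end BinaryWeight

section Wood

variable {k : ℕ}

/-- The squarefree monomial `∏_{j ∈ s} x_j`. -/
noncomputable def varProd (s : Finset (Fin k)) : PolyAlg k := ∏ j ∈ s, X j

@[simp] theorem varProd_empty : varProd (∅ : Finset (Fin k)) = 1 :=
  Finset.prod_empty

theorem varProd_mem_degreeIn (s : Finset (Fin k)) : varProd s ∈ degreeIn k {s.card} := by
  induction s using Finset.induction_on with
  | empty => exact one_mem_degreeIn rfl
  | insert j s hj ih =>
    rw [varProd, Finset.prod_insert hj, Finset.card_insert_of_notMem hj]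
    exact mul_mem_degreeIn (X_mem_degreeIn j) ih (by simp [add_comm])

theorem X_mul_varProd_erase {s : Finset (Fin k)} {j : Fin k} (hj : j ∈ s) :
    X j * varProd (s.erase j) = varProd s :=
  Finset.mul_prod_erase s _ hj

theorem X_mul_varProd {s : Finset (Fin k)} {j : Fin k} (hj : j ∈ s) :
    X j * varProd s = varProd (s.erase j) * X j ^ 2 := by
  rw [← X_mul_varProd_erase hj]
  ring

/-- The linear map `y ↦ f y²`. -/
noncomputable def mulSq (f : PolyAlg k) : PolyAlg k →ₗ[ZMod 2] PolyAlg k :=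
  (LinearMap.mulLeft (ZMod 2) f).comp
    ((frobenius (PolyAlg k) 2).toAddMonoidHom.toZModLinearMap 2)

@[simp] theorem mulSq_apply (f y : PolyAlg k) : mulSq f y = f * y ^ 2 := rfl

theorem mulSq_varProd_monomial_mem_degreeIn (s : Finset (Fin k)) (e : Fin k →₀ ℕ) :
    mulSq (varProd s) (monomial e 1) ∈ degreeIn k {s.card + 2 * e.degree} := by
  rw [mulSq_apply, monomial_one_sq]
  exact mul_mem_degreeIn (varProd_mem_degreeIn s)
    (monomial_mem_degreeIn (A := {2 * e.degree}) (by simp) 1) (by simp)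

theorem exists_monomial_eq_mulSq_varProd (e : Fin k →₀ ℕ) :
    ∃ (s : Finset (Fin k)) (e' : Fin k →₀ ℕ),
      (monomial e 1 : PolyAlg k) = mulSq (varProd s) (monomial e' 1) := by
  induction e using exponent_induction with
  | zero => exact ⟨∅, 0, by simp [varProd]⟩
  | single_add j e ih =>
    obtain ⟨s, e', h⟩ := ih
    rw [monomial_single_one_add, h]
    by_cases hj : j ∈ s
    · refine ⟨s.erase j, Finsupp.single j 1 + e', ?_⟩
      rw [monomial_single_one_add, mulSq_apply, mulSq_apply, ← mul_assoc, X_mul_varProd hj]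
      ring
    · refine ⟨insert j s, e', ?_⟩
      rw [mulSq_apply, mulSq_apply, ← mul_assoc, varProd, varProd, Finset.prod_insert hj]

theorem sqSum_mulSq_varProd (s : Finset (Fin k)) (g : PolyAlg k) :
    sqSum k (mulSq (varProd s) g) =
      ∑ t ∈ s.powerset, mulSq (varProd t) (varProd (s \ t) * sqSum k g) := by
  rw [mulSq_apply, map_mul, map_pow, varProd, map_prod]
  simp_rw [sqSum_X]
  rw [Finset.prod_add, Finset.sum_mul]
  refine Finset.sum_congr rfl fun t _ => ?_
  rw [mulSq_apply, mul_pow, varProd, varProd, Finset.prod_pow]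
  ring

/-- The truncation `∑_{a < A} x_j^(2^a)` of the formal inverse image of `x_j` under `sqSum`. -/
noncomputable def twoPowSum (A : ℕ) (j : Fin k) : PolyAlg k := ∑ a ∈ Finset.range A, X j ^ 2 ^ a

theorem sqSum_twoPowSum (A : ℕ) (j : Fin k) :
    sqSum k (twoPowSum A j) = X j + X j ^ 2 ^ A := by
  simp_rw [twoPowSum, map_sum, map_pow, sqSum_X, add_pow_char_pow, ← pow_mul, ← pow_succ',
    ← ZModModule.sub_eq_add, Finset.sum_range_sub', pow_zero, pow_one]

theorem prod_twoPowSum_mem_degreeIn (A : ℕ) (s : Finset (Fin k)) :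
    ∏ j ∈ s, twoPowSum A j ∈ degreeIn k {D | binaryWeight D ≤ s.card} := by
  induction s using Finset.induction_on with
  | empty => exact one_mem_degreeIn (binaryWeight_le_self 0)
  | insert j s hj ih =>
    rw [Finset.prod_insert hj, Finset.card_insert_of_notMem hj]
    refine mul_mem_degreeIn (A := {D | binaryWeight D ≤ 1}) ?_ ih fun a ha b hb => ?_
    · exact Submodule.sum_mem _ fun a _ => X_pow_mem_degreeIn
        (A := {D | binaryWeight D ≤ 1}) (binaryWeight_two_pow a).le j
    · exact (binaryWeight_add_le a b).trans (by
        rw [add_comm]; exact add_le_add hb ha)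

theorem prod_X_add_X_pow_sub_varProd_mem_degreeIn (B : ℕ) (s : Finset (Fin k)) :
    ∏ j ∈ s, (X j + X j ^ B) - varProd s ∈ degreeIn k (Set.Ici B) := by
  induction s using Finset.induction_on with
  | empty => simp [varProd]
  | insert j s hj ih =>
    rw [varProd, Finset.prod_insert hj, Finset.prod_insert hj, ← varProd]
    have hsplit : (X j + X j ^ B) * ∏ i ∈ s, (X i + X i ^ B) - X j * varProd s =
        X j * (∏ i ∈ s, (X i + X i ^ B) - varProd s) +
          X j ^ B * ∏ i ∈ s, (X i + X i ^ B) := by ring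
    rw [hsplit]
    refine add_mem (mul_mem_degreeIn (X_mem_degreeIn j) ih ?_)
      (mul_mem_degreeIn (B := Set.univ) (X_pow_mem_degreeIn (A := {B}) rfl j) ?_ ?_)
    · rintro _ rfl b hb
      exact Nat.le_add_left_of_le hb
    · rw [degreeIn_univ]
      trivial
    · rintro _ rfl b -
      exact Nat.le_add_right _ b

theorem mulSq_varProd_monomial_mem_hitAt {s : Finset (Fin k)} {e : Fin k →₀ ℕ}
    (he : s.card < binaryWeight (s.card + e.degree)) :
    mulSq (varProd s) (monomial e 1) ∈ hitAt k (s.card + 2 * e.degree) := by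
  set N := s.card + 2 * e.degree
  set g : PolyAlg k := monomial e 1
  set F : PolyAlg k := ∏ j ∈ s, twoPowSum N j
  set G : PolyAlg k := ∏ j ∈ s, (X j + X j ^ 2 ^ N)
  have hFg : F * g ∈ hitAt k N := by
    refine degreeIn_le_hitAt (A := {N}ᶜ) (by simp) (mul_mem_degreeIn
      (prod_twoPowSum_mem_degreeIn N s) (monomial_mem_degreeIn (A := {e.degree}) rfl 1) ?_)
    rintro D hD _ rfl hDN
    rw [Set.mem_singleton_iff] at hDN
    rw [show s.card + e.degree = D by omega] at he
    exact he.not_ge hD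
  have hGg : G * sqSum k g ∈ hitAt k N := by
    have h := add_mem (sqSum_sub_mem_hitAt N (F * g)) hFg
    rw [sub_add_cancel, map_mul, map_prod] at h
    simpa only [sqSum_twoPowSum] using h
  have hhigh : (G - varProd s) * sqSum k g ∈ hitAt k N := by
    refine degreeIn_le_hitAt (A := Set.Ici (2 ^ N)) (by simpa using Nat.lt_two_pow_self)
      (mul_mem_degreeIn (B := Set.univ) (prod_X_add_X_pow_sub_varProd_mem_degreeIn _ s) ?_ ?_)
    · rw [degreeIn_univ]
      trivial
    · intro a ha b _
      exact Nat.le_add_right_of_le ha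
  have hlow : varProd s * (sqSum k g - g ^ 2) ∈ hitAt k N := by
    refine degreeIn_le_hitAt (A := Set.Iio N) (by simp) (mul_mem_degreeIn
      (varProd_mem_degreeIn s) (sqSum_monomial_sub_sq_mem_degreeIn e) ?_)
    rintro _ rfl b hb
    exact Nat.add_lt_add_left hb _
  have hsum : varProd s * g ^ 2 =
      G * sqSum k g - (G - varProd s) * sqSum k g - varProd s * (sqSum k g - g ^ 2) := by ring
  rw [mulSq_apply, hsum]
  exact sub_mem (sub_mem hGg hhigh) hlow

theorem mulSq_varProd_mem_hitAt {N : ℕ} {s : Finset (Fin k)}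
    (hN : s.card < binaryWeight (N + s.card)) (y : PolyAlg k) :
    mulSq (varProd s) y ∈ hitAt k N := by
  refine map_mem_of_monomial (mulSq (varProd s)) (fun e => ?_) y
  by_cases he : s.card + 2 * e.degree = N
  · subst he
    rw [show s.card + 2 * e.degree + s.card = 2 * (s.card + e.degree) by ring,
      binaryWeight_two_mul] at hN
    exact mulSq_varProd_monomial_mem_hitAt hN
  · exact mem_hitAt_of_ne (mulSq_varProd_monomial_mem_degreeIn s e) he

end Wood

section Lift

variable {q M : ℕ}

/-- In degree `N`, every monomial in `q + 1` variables with fewer than `q` odd exponents is hit. -/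
def SparseHit (q N : ℕ) : Prop :=
  ∀ s : Finset (Fin (q + 1)), s.card < q → ∀ y, mulSq (varProd s) y ∈ hitAt (q + 1) N

theorem card_lt_or_eq_compl_singleton_or_eq_univ (s : Finset (Fin (q + 1))) :
    s.card < q ∨ (∃ j, s = {j}ᶜ) ∨ s = Finset.univ := by
  have hcard := Finset.card_add_card_compl s
  rw [Fintype.card_fin] at hcard
  rcases lt_or_ge s.card q with hs | hs
  · exact Or.inl hs
  right
  obtain h0 | h1 : sᶜ.card = 0 ∨ sᶜ.card = 1 := by omega
  · exact Or.inr (by simpa using h0)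
  · obtain ⟨j, hj⟩ := Finset.card_eq_one.1 h1
    exact Or.inl ⟨j, by rw [← hj, compl_compl]⟩

theorem card_compl_singleton (j : Fin (q + 1)) : ({j}ᶜ : Finset (Fin (q + 1))).card = q := by
  simp [Finset.card_compl]

theorem mulSq_varProd_univ_mem_hitAt (M : ℕ) (y : PolyAlg (q + 1)) :
    mulSq (varProd Finset.univ) y ∈ hitAt (q + 1) (2 * M + q) := by
  refine map_mem_of_monomial (mulSq (varProd Finset.univ)) (fun e => ?_) y
  refine mem_hitAt_of_ne (mulSq_varProd_monomial_mem_degreeIn _ e) ?_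
  rw [Finset.card_fin]
  omega

/-- The map `y ↦ x₁ ⋯ x̂_j ⋯ x_{q+1} y²`, the omitted variable being `x_j`. -/
noncomputable def lift (j : Fin (q + 1)) : PolyAlg (q + 1) →ₗ[ZMod 2] PolyAlg (q + 1) :=
  mulSq (varProd {j}ᶜ)

theorem lift_X_mul (j : Fin (q + 1)) (y : PolyAlg (q + 1)) :
    lift j (X j * y) = X j * mulSq (varProd Finset.univ) y := by
  rw [lift, mulSq_apply, mulSq_apply, ← X_mul_varProd_erase (Finset.mem_univ j),
    ← Finset.compl_singleton]
  ring

theorem SparseHit.lift_mem_hitAt (h : SparseHit q (2 * M + q)) (j : Fin (q + 1))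
    {y : PolyAlg (q + 1)} (hy : y ∈ hitAt (q + 1) M) : lift j y ∈ hitAt (q + 1) (2 * M + q) := by
  refine map_mem_of_mem_hitAt (lift j) (fun g => ?_) (fun e he => ?_) hy
  · have hsq := sqSum_sub_mem_hitAt (2 * M + q) (lift j g)
    rw [lift, sqSum_mulSq_varProd, ← Finset.add_sum_erase _ _ (Finset.mem_powerset_self _),
      Finset.sdiff_self, varProd_empty, one_mul, add_sub_right_comm, ← lift, ← map_sub] at hsq
    refine ((hitAt _ _).add_mem_iff_left (Submodule.sum_mem _ fun t ht => h t ?_ _)).1 hsq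
    rw [Finset.mem_erase, Finset.mem_powerset] at ht
    exact (Finset.card_lt_card (Finset.ssubset_iff_subset_ne.2 ⟨ht.2, ht.1⟩)).trans_eq
      (card_compl_singleton j)
  · refine mem_hitAt_of_ne (mulSq_varProd_monomial_mem_degreeIn _ e) ?_
    rw [card_compl_singleton]
    omega

section VarSum

variable {V : Type*} [AddCommGroup V] [Module (ZMod 2) V] {k : ℕ}

/-- The linear map `u ↦ ∑_j E_j (x_j u)`. -/
noncomputable def varSum (E : Fin k → PolyAlg k →ₗ[ZMod 2] V) : PolyAlg k →ₗ[ZMod 2] V :=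
  ∑ j, (E j).comp (LinearMap.mulLeft (ZMod 2) (X j))

theorem varSum_apply (E : Fin k → PolyAlg k →ₗ[ZMod 2] V) (u : PolyAlg k) :
    varSum E u = ∑ j, E j (X j * u) := by
  simp [varSum]

end VarSum

theorem SparseHit.sum_varProd_mul_modEq (h : SparseHit q (2 * M + q))
    (f : Finset (Fin (q + 1)) → PolyAlg (q + 1)) :
    ∑ t, mulSq (varProd t) (f t) ≡ ∑ j, lift j (f {j}ᶜ) [SMOD hitAt (q + 1) (2 * M + q)] := by
  rw [SModEq, ← Submodule.mkQ_apply, ← Submodule.mkQ_apply, map_sum, map_sum]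
  symm
  refine Finset.sum_of_injOn (fun j => {j}ᶜ) ?_ (by simp) (fun t _ ht => ?_)
    fun j _ => by rw [lift]
  · exact (compl_injective.comp Finset.singleton_injective).injOn
  · rw [Submodule.mkQ_apply, Submodule.Quotient.mk_eq_zero]
    rcases card_lt_or_eq_compl_singleton_or_eq_univ t with hlt | ⟨j, rfl⟩ | rfl
    · exact h t hlt _
    · exact absurd ⟨j, by simp⟩ ht
    · exact mulSq_varProd_univ_mem_hitAt M _

theorem SparseHit.varSum_lift_mem_hitAt (h : SparseHit q (2 * M + q)) (g : PolyAlg (q + 1)) :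
    varSum lift g ∈ hitAt (q + 1) (2 * M + q) := by
  refine map_mem_of_sqSum (varSum lift) (M - 1) (fun e he => ?_) (fun g => ?_) g
  · rw [varSum_apply]
    refine Submodule.sum_mem _ fun j _ => ?_
    rw [← monomial_single_one_add]
    refine mem_hitAt_of_ne (mulSq_varProd_monomial_mem_degreeIn _ _) ?_
    rw [card_compl_singleton, map_add, Finsupp.degree_single]
    omega
  · have hsq := sqSum_sub_mem_hitAt (2 * M + q) (mulSq (varProd Finset.univ) g)
    rw [sqSum_mulSq_varProd, Submodule.sub_mem_iff_left _ (mulSq_varProd_univ_mem_hitAt M g),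
      Finset.powerset_univ] at hsq
    have hsum := h.sum_varProd_mul_modEq fun t => varProd (Finset.univ \ t) * sqSum _ g
    rw [varSum_apply]
    simpa [varProd, ← Finset.compl_eq_univ_sdiff] using
      SModEq.zero.1 (hsum.symm.trans (SModEq.zero.2 hsq))

theorem X_mul_varProd_compl_pair {a b : Fin (q + 1)} (hab : a ≠ b) (w : PolyAlg (q + 1)) :
    X a * mulSq (varProd {a, b}ᶜ) w = lift b w := by
  have hinsert : ({b}ᶜ : Finset (Fin (q + 1))) = insert a {a, b}ᶜ := by
    ext i
    by_cases hi : i = a <;> simp [hi, hab]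
  rw [lift, mulSq_apply, mulSq_apply, ← mul_assoc, hinsert, varProd, varProd,
    Finset.prod_insert (by simp)]

/-- The relation `∑ ψ_j (x_j g) = 0` evaluated at `g = x₁ ⋯ x̂_a ⋯ x̂_b ⋯ x_{q+1} w²`. -/
theorem SparseHit.comp_lift_modEq {V : Type*} [AddCommGroup V] [Module (ZMod 2) V]
    {W : Submodule (ZMod 2) V} (h : SparseHit q M)
    {ψ : Fin (q + 1) → PolyAlg (q + 1) →ₗ[ZMod 2] V}
    (hψ : ∀ j, ∀ y ∈ hitAt (q + 1) M, ψ j y ∈ W) (hsum : ∀ g, varSum ψ g ∈ W)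
    {a b : Fin (q + 1)} (hab : a ≠ b) (w : PolyAlg (q + 1)) :
    ψ a (lift b w) ≡ ψ b (lift a w) [SMOD W] := by
  have hrel := hsum (mulSq (varProd {a, b}ᶜ) w)
  rw [varSum_apply, ← Finset.sum_add_sum_compl {a, b}, Finset.sum_pair hab,
    X_mul_varProd_compl_pair hab, Finset.pair_comm, X_mul_varProd_compl_pair hab.symm] at hrel
  rw [SModEq.sub_mem, ZModModule.sub_eq_add]
  refine (Submodule.add_mem_iff_left _ (Submodule.sum_mem _ fun j hj => hψ j _ ?_)).1 hrel
  rw [mulSq_apply, ← mul_assoc, X_mul_varProd hj, mul_assoc, ← mul_pow]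
  refine h _ ?_ (X j * w)
  rw [Finset.card_erase_of_mem hj, Finset.card_compl, Fintype.card_fin,
    Finset.card_pair hab.symm]
  have := Finset.card_le_univ {a, b}
  rw [Finset.card_pair hab, Fintype.card_fin] at this
  omega

end Lift

section IteratedLift

variable {q M : ℕ}

/-- The degree of the image of a polynomial of degree `M` under `t` lifts. -/
def liftDegree (q M : ℕ) : ℕ → ℕ
  | 0 => M
  | t + 1 => 2 * liftDegree q M t + q

theorem liftDegree_add (q M t : ℕ) : liftDegree q M t + q = 2 ^ t * (M + q) := by
  induction t with
  | zero => rw [liftDegree, pow_zero, one_mul]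
  | succ t ih =>
    rw [liftDegree, pow_succ', mul_assoc, ← ih]
    ring

/-- The monomials with fewer than `q` odd exponents are hit in all degrees in which lifts of
polynomials of degree `M` live. -/
def SparseHitTower (q M : ℕ) : Prop :=
  ∀ t, SparseHit q (liftDegree q M (t + 1))

theorem sparseHitTower_of_le_binaryWeight (h : q ≤ binaryWeight (M + q - 1) + 1) :
    SparseHitTower q M := by
  intro t s hs y
  have hdeg := liftDegree_add q M (t + 1)
  have hweight := binaryWeight_two_pow_mul_sub_one (t + 1) (n := M + q) (by omega)
  have hadd := binaryWeight_add_le (liftDegree q M (t + 1) + s.card) (q - 1 - s.card)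
  rw [show liftDegree q M (t + 1) + s.card + (q - 1 - s.card) = 2 ^ (t + 1) * (M + q) - 1 by omega,
    hweight] at hadd
  have hle := binaryWeight_le_self (q - 1 - s.card)
  exact mulSq_varProd_mem_hitAt (by omega) y

/-- The composite of the maps `lift j` along a list. -/
noncomputable def lifts (J : List (Fin (q + 1))) : PolyAlg (q + 1) →ₗ[ZMod 2] PolyAlg (q + 1) :=
  J.foldr (fun j φ => (lift j).comp φ) LinearMap.id

@[simp] theorem lifts_nil (y : PolyAlg (q + 1)) : lifts [] y = y := rfl

@[simp] theorem lifts_cons (j : Fin (q + 1)) (J : List (Fin (q + 1))) (y : PolyAlg (q + 1)) :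
    lifts (j :: J) y = lift j (lifts J y) := rfl

theorem lifts_append (J J' : List (Fin (q + 1))) (y : PolyAlg (q + 1)) :
    lifts (J ++ J') y = lifts J (lifts J' y) := by
  induction J with
  | nil => rfl
  | cons j J ih => rw [List.cons_append, lifts_cons, ih, lifts_cons]

theorem SparseHitTower.lifts_mem_hitAt (h : SparseHitTower q M) (J : List (Fin (q + 1))) {t : ℕ}
    {y : PolyAlg (q + 1)} (hy : y ∈ hitAt (q + 1) (liftDegree q M t)) :
    lifts J y ∈ hitAt (q + 1) (liftDegree q M (t + J.length)) := by
  induction J with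
  | nil => exact hy
  | cons j J ih => exact (h _).lift_mem_hitAt j ih

theorem lifts_replicate_X_mul (s : ℕ) (j : Fin (q + 1)) (u : PolyAlg (q + 1)) :
    lifts (List.replicate s j) (X j * u) = X j * (mulSq (varProd Finset.univ))^[s] u := by
  induction s with
  | zero => rfl
  | succ s ih =>
    rw [List.replicate_succ, lifts_cons, ih, lift_X_mul, Function.iterate_succ_apply']

theorem SparseHit.varSum_lifts_replicate_mem_hitAt (h : SparseHit q (2 * M + q)) (s : ℕ)
    (u : PolyAlg (q + 1)) :
    varSum (fun j => lifts (List.replicate (s + 1) j)) u ∈ hitAt (q + 1) (2 * M + q) := by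
  have hlift := h.varSum_lift_mem_hitAt ((mulSq (varProd Finset.univ))^[s] u)
  rw [varSum_apply] at hlift ⊢
  simpa only [List.replicate_succ, lifts_cons, lifts_replicate_X_mul] using hlift

/-- Two lists of omitted variables are equivalent if they have the same length and the
corresponding lifts of polynomials of degree `M` agree up to hit polynomials. -/
def LiftEquiv (q M : ℕ) (J J' : List (Fin (q + 1))) : Prop :=
  J.length = J'.length ∧
    ∀ y, lifts J y ≡ lifts J' y [SMOD hitAt (q + 1) (liftDegree q M J.length)]

namespace LiftEquiv

variable {J J' J'' : List (Fin (q + 1))}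

theorem refl (J : List (Fin (q + 1))) : LiftEquiv q M J J :=
  ⟨rfl, fun _ => SModEq.rfl⟩

theorem symm (h : LiftEquiv q M J J') : LiftEquiv q M J' J :=
  ⟨h.1.symm, fun y => h.1 ▸ (h.2 y).symm⟩

theorem trans (h : LiftEquiv q M J J') (h' : LiftEquiv q M J' J'') : LiftEquiv q M J J'' :=
  ⟨h.1.trans h'.1, fun y => (h.2 y).trans (h.1 ▸ h'.2 y)⟩

theorem cons (hM : SparseHitTower q M) (j : Fin (q + 1)) (h : LiftEquiv q M J J') :
    LiftEquiv q M (j :: J) (j :: J') := by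
  refine ⟨congrArg (· + 1) h.1, fun y => ?_⟩
  rw [lifts_cons, lifts_cons, SModEq.sub_mem, ← map_sub]
  exact (hM _).lift_mem_hitAt j (SModEq.sub_mem.1 (h.2 y))

theorem swap (hM : SparseHitTower q M) (a b : Fin (q + 1)) (J : List (Fin (q + 1))) :
    LiftEquiv q M (a :: b :: J) (b :: a :: J) := by
  rcases eq_or_ne a b with rfl | hab
  · exact refl _
  · exact ⟨rfl, fun y => (hM J.length).comp_lift_modEq
      (fun j _ => (hM (J.length + 1)).lift_mem_hitAt j)
      (hM (J.length + 1)).varSum_lift_mem_hitAt hab (lifts J y)⟩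

theorem contract (hM : SparseHitTower q M) (a b : Fin (q + 1)) (J : List (Fin (q + 1))) :
    LiftEquiv q M (a :: a :: b :: J) (b :: b :: a :: J) := by
  rcases eq_or_ne a b with rfl | hab
  · exact refl _
  · exact ⟨rfl, fun y => (hM J.length).comp_lift_modEq
      (ψ := fun j => lifts (List.replicate 2 j)) (fun j _ => hM.lifts_mem_hitAt [j, j])
      ((hM (J.length + 2)).varSum_lifts_replicate_mem_hitAt 1) hab (lifts J y)⟩

theorem of_perm (hM : SparseHitTower q M) (h : J.Perm J') : LiftEquiv q M J J' := by
  induction h with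
  | nil => exact refl _
  | cons j _ ih => exact ih.cons hM j
  | swap a b J => exact swap hM _ _ _
  | trans _ _ h h' => exact h.trans h'

theorem cons_of_mem (hM : SparseHitTower q M) {a b : Fin (q + 1)} (ha : a ∈ J) (hb : b ∈ J) :
    LiftEquiv q M (a :: J) (b :: J) := by
  rcases eq_or_ne a b with rfl | hab
  · exact refl _
  have hb' : b ∈ J.erase a := (List.mem_erase_of_ne hab.symm).2 hb
  have hJ : J.Perm (a :: b :: (J.erase a).erase b) :=
    (List.perm_cons_erase ha).trans ((List.perm_cons_erase hb').cons a)
  exact ((of_perm hM (hJ.cons a)).trans (contract hM a b _)).trans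
    (of_perm hM ((hJ.trans (List.Perm.swap _ _ _)).symm.cons b))

end LiftEquiv

theorem exists_perm_cons_of_not_nodup {α : Type*} [DecidableEq α] {J : List α} (h : ¬J.Nodup) :
    ∃ a J', J.Perm (a :: J') ∧ a ∈ J' ∧ J.toFinset = J'.toFinset := by
  obtain ⟨a, ha⟩ := List.exists_duplicate_iff_not_nodup.2 h
  have hcount := List.duplicate_iff_two_le_count.1 ha
  have hperm := List.perm_cons_erase ha.mem
  have ha' : a ∈ J.erase a := by
    rw [← List.count_pos_iff, List.count_erase_self]
    omega
  refine ⟨a, J.erase a, hperm, ha', ?_⟩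
  rw [List.toFinset_eq_of_perm _ _ hperm, List.toFinset_cons,
    Finset.insert_eq_self.2 (List.mem_toFinset.2 ha')]

theorem LiftEquiv.of_toFinset (hM : SparseHitTower q M) {J J' : List (Fin (q + 1))}
    (hlen : J.length = J'.length) (hset : J.toFinset = J'.toFinset) : LiftEquiv q M J J' := by
  induction h : J.length generalizing J J' with
  | zero =>
    obtain rfl : J = [] := List.length_eq_zero_iff.1 h
    obtain rfl : J' = [] := List.length_eq_zero_iff.1 hlen.symm
    exact LiftEquiv.refl _
  | succ n ih =>
    have hnodup : J.Nodup ↔ J'.Nodup := by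
      rw [← Multiset.coe_nodup, ← Multiset.coe_nodup, ← Multiset.toFinset_card_eq_card_iff_nodup,
        ← Multiset.toFinset_card_eq_card_iff_nodup, Multiset.coe_card, Multiset.coe_card, hlen]
      exact iff_of_eq (congrArg (Finset.card · = _) hset)
    by_cases hJ : J.Nodup
    · exact of_perm hM (List.perm_of_nodup_nodup_toFinset_eq hJ (hnodup.1 hJ) hset)
    obtain ⟨a, J₁, hperm, ha, hset₁⟩ := exists_perm_cons_of_not_nodup hJ
    obtain ⟨b, J₂, hperm', hb, hset₂⟩ := exists_perm_cons_of_not_nodup (mt hnodup.2 hJ)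
    have hset' : J₁.toFinset = J₂.toFinset := hset₁.symm.trans (hset.trans hset₂)
    have hlen₁ := hperm.length_eq
    have hlen₂ := hperm'.length_eq
    rw [List.length_cons] at hlen₁ hlen₂
    have htail : LiftEquiv q M J₁ J₂ := ih (by omega) hset' (by omega)
    have hb' : b ∈ J₁ := by rwa [← List.mem_toFinset, hset', List.mem_toFinset]
    exact (((of_perm hM hperm).trans (cons_of_mem hM ha hb')).trans
      (htail.cons hM b)).trans (of_perm hM hperm').symm

end IteratedLift

section SetLift

variable {q M d : ℕ}

/-- A list of length `d` with underlying set `S`, provided `S` is nonempty and has at most `d`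
elements. -/
noncomputable def padList (d : ℕ) (S : Finset (Fin (q + 1))) : List (Fin (q + 1)) :=
  S.toList ++ List.replicate (d - S.card) (S.toList.headD 0)

theorem length_padList {S : Finset (Fin (q + 1))} (hS : S.card ≤ d) :
    (padList d S).length = d := by
  rw [padList, List.length_append, Finset.length_toList, List.length_replicate,
    Nat.add_sub_cancel' hS]

theorem toFinset_padList {S : Finset (Fin (q + 1))} (hS : S.Nonempty) :
    (padList d S).toFinset = S := by
  obtain ⟨a, J, hJ⟩ := List.exists_cons_of_ne_nil (mt Finset.toList_eq_nil.1 hS.ne_empty)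
  have ha : a ∈ S := by rw [← Finset.mem_toList, hJ]; exact List.mem_cons_self
  ext i
  rw [List.mem_toFinset, padList, List.mem_append, Finset.mem_toList, hJ, List.headD_cons]
  exact or_iff_left_of_imp fun h => List.eq_of_mem_replicate h ▸ ha

/-- The `d`-fold lift whose set of omitted variables is `S`. -/
noncomputable def setLift (d : ℕ) (S : Finset (Fin (q + 1))) :
    PolyAlg (q + 1) →ₗ[ZMod 2] PolyAlg (q + 1) :=
  lifts (padList d S)

theorem SparseHitTower.setLift_mem_hitAt (hM : SparseHitTower q M) {S : Finset (Fin (q + 1))}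
    (hS : S.card ≤ d) {y : PolyAlg (q + 1)} (hy : y ∈ hitAt (q + 1) M) :
    setLift d S y ∈ hitAt (q + 1) (liftDegree q M d) := by
  have h := hM.lifts_mem_hitAt (padList d S) (t := 0) hy
  rwa [zero_add, length_padList hS] at h

theorem SparseHitTower.lifts_modEq_setLift (hM : SparseHitTower q M) {J : List (Fin (q + 1))}
    (hJ : J ≠ []) (y : PolyAlg (q + 1)) :
    lifts J y ≡ setLift J.length J.toFinset y
      [SMOD hitAt (q + 1) (liftDegree q M J.length)] :=
  (LiftEquiv.of_toFinset hM (length_padList J.toFinset_card_le).symm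
    (toFinset_padList ((List.toFinset_nonempty_iff J).2 hJ)).symm).2 y

theorem SparseHitTower.eq_top_of_lifts_mem (hM : SparseHitTower q M)
    {W : Submodule (ZMod 2) (PolyAlg (q + 1))} (hW : hitAt (q + 1) (liftDegree q M d) ≤ W)
    (hlifts : ∀ J : List (Fin (q + 1)), J.length = d → ∀ y, lifts J y ∈ W) : W = ⊤ := by
  induction d generalizing W with
  | zero => exact Submodule.eq_top_iff'.2 (hlifts [] rfl)
  | succ d ih =>
    refine Submodule.eq_top_iff'.2 (map_mem_of_monomial LinearMap.id fun e => ?_)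
    obtain ⟨s, e', he⟩ := exists_monomial_eq_mulSq_varProd e
    rw [LinearMap.id_apply, he]
    rcases card_lt_or_eq_compl_singleton_or_eq_univ s with hlt | ⟨j, rfl⟩ | rfl
    · exact hW (hM d s hlt _)
    · have hcomap : W.comap (lift j) = ⊤ := ih (fun y hy => hW ((hM d).lift_mem_hitAt j hy))
        fun J hJ y => hlifts (j :: J) (congrArg (· + 1) hJ) y
      exact Submodule.eq_top_iff'.1 hcomap (monomial e' 1)
    · exact hW (mulSq_varProd_univ_mem_hitAt _ _)

theorem SparseHitTower.exists_modEq_sum_setLift (hM : SparseHitTower q M) (hd : 0 < d)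
    (f : PolyAlg (q + 1)) :
    ∃ y : Finset (Fin (q + 1)) → PolyAlg (q + 1), (∀ S, ¬(S.Nonempty ∧ S.card ≤ d) → y S = 0) ∧
      f ≡ ∑ S, setLift d S (y S) [SMOD hitAt (q + 1) (liftDegree q M d)] := by
  set H := hitAt (q + 1) (liftDegree q M d)
  let A : Finset (Finset (Fin (q + 1))) := {S | S.Nonempty ∧ S.card ≤ d}
  have htop : H ⊔ ⨆ S ∈ A, LinearMap.range (setLift d S) = ⊤ := by
    refine hM.eq_top_of_lifts_mem le_sup_left fun J hJ y => ?_
    have hne : J ≠ [] := List.ne_nil_of_length_pos (hJ ▸ hd)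
    have hA : J.toFinset ∈ A := Finset.mem_filter.2 ⟨Finset.mem_univ _,
      (List.toFinset_nonempty_iff J).2 hne, hJ ▸ J.toFinset_card_le⟩
    have hmod := hM.lifts_modEq_setLift hne y
    rw [hJ, SModEq.sub_mem] at hmod
    rw [← sub_add_cancel (lifts J y)]
    exact Submodule.add_mem_sup hmod (Submodule.mem_iSup_of_mem _ (Submodule.mem_iSup_of_mem hA
      (LinearMap.mem_range_self _ _)))
  obtain ⟨r, hr, g, hg, rfl⟩ := Submodule.mem_sup.1 (htop.ge (Submodule.mem_top (x := f)))
  obtain ⟨μ, rfl⟩ := (Submodule.mem_iSup_finset_iff_exists_sum _ _).1 hg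
  choose z hz using fun S => (μ S).2
  refine ⟨fun S => if S.Nonempty ∧ S.card ≤ d then z S else 0, fun S hS => if_neg hS, ?_⟩
  rw [SModEq.sub_mem]
  simpa [← hz, A, Finset.sum_filter, apply_ite, add_sub_assoc] using hr

theorem SparseHitTower.varSum_setLift_insert_mem_hitAt (hM : SparseHitTower q M)
    {T : Finset (Fin (q + 1))} (hT : T.card < d) (u : PolyAlg (q + 1)) :
    varSum (fun j => setLift d (insert j T)) u ∈ hitAt (q + 1) (liftDegree q M d) := by
  obtain ⟨s, rfl⟩ := Nat.exists_eq_add_of_lt hT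
  let J (j : Fin (q + 1)) : List (Fin (q + 1)) := T.toList ++ List.replicate (s + 1) j
  have hlen (j) : (J j).length = T.card + s + 1 := by simp [J, add_assoc]
  have hset (j) : (J j).toFinset = insert j T := by
    ext i
    simp [J, List.mem_replicate, or_comm]
  have hJ : varSum (fun j => lifts (J j)) u ∈
      hitAt (q + 1) (liftDegree q M (T.card + s + 1)) := by
    have hrep : varSum (fun j => lifts (List.replicate (s + 1) j)) u ∈
        hitAt (q + 1) (liftDegree q M (s + 1)) := (hM s).varSum_lifts_replicate_mem_hitAt s u
    have h := hM.lifts_mem_hitAt T.toList hrep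
    rw [Finset.length_toList, show s + 1 + T.card = T.card + s + 1 by ring] at h
    simpa only [varSum_apply, J, lifts_append, map_sum] using h
  have hmod : varSum (fun j => lifts (J j)) u ≡
      varSum (fun j => setLift (T.card + s + 1) (insert j T)) u
        [SMOD hitAt (q + 1) (liftDegree q M (T.card + s + 1))] := by
    rw [varSum_apply, varSum_apply]
    refine SModEq.sum fun j _ => ?_
    have h := hM.lifts_modEq_setLift (J := J j) (by simp [J]) (X j * u)
    rwa [hlen, hset] at h
  exact SModEq.zero.1 (hmod.symm.trans (SModEq.zero.2 hJ))

end SetLift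

section SubsetFamily

variable {k : ℕ} {V : Type*} [AddCommGroup V] [Module (ZMod 2) V]

/-- The linear form `∑_{j ∈ L} x_j`. -/
noncomputable def form (L : Finset (Fin k)) : PolyAlg k := ∑ j ∈ L, X j

@[simp] theorem form_empty : form (∅ : Finset (Fin k)) = 0 :=
  Finset.sum_empty

@[simp] theorem form_singleton (j : Fin k) : form {j} = X j :=
  Finset.sum_singleton _ _

theorem form_pair {i j : Fin k} (h : i ≠ j) : form {i, j} = X i + X j :=
  Finset.sum_pair h

theorem sqSum_form (L : Finset (Fin k)) : sqSum k (form L) = form L + form L ^ 2 := by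
  rw [form, map_sum, sum_pow_char, ← Finset.sum_add_distrib]
  exact Finset.sum_congr rfl fun j _ => sqSum_X j

variable (E : Finset (Fin k) → PolyAlg k →ₗ[ZMod 2] V)

/-- The sum of `E S` over the supersets `S` of `L`. -/
noncomputable def upSum (L : Finset (Fin k)) : PolyAlg k →ₗ[ZMod 2] V :=
  ∑ S with L ⊆ S, E S

/-- The linear map `u ↦ ∑_j E_{T ∪ {j}}(x_j u)`. -/
noncomputable def relSum (T : Finset (Fin k)) : PolyAlg k →ₗ[ZMod 2] V :=
  varSum fun j => E (insert j T)

theorem upSum_apply (L : Finset (Fin k)) (y : PolyAlg k) :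
    upSum E L y = ∑ S with L ⊆ S, E S y := by
  rw [upSum, LinearMap.sum_apply]

theorem relSum_apply (T : Finset (Fin k)) (u : PolyAlg k) :
    relSum E T u = ∑ j, E (insert j T) (X j * u) :=
  varSum_apply _ u

theorem sum_superset_insert_eq_zero {L : Finset (Fin k)} {j : Fin k} (hj : j ∉ L)
    (v : Finset (Fin k) → V) : ∑ T with L ⊆ T, v (insert j T) = 0 := by
  have hinsert (T : Finset (Fin k)) : insert j (symmDiff T {j}) = insert j T := by
    ext i
    by_cases hi : i = j <;> simp [Finset.mem_symmDiff, hi]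
  refine Finset.sum_involution (fun T _ => symmDiff T {j}) (fun T _ => ?_) (fun T _ _ h => ?_)
    (fun T hT => ?_) fun T _ => symmDiff_symmDiff_cancel_right _ _
  · rw [hinsert, ZModModule.add_self]
  · exact Finset.singleton_ne_empty j (symmDiff_eq_left.1 h)
  · rw [Finset.mem_filter] at hT ⊢
    refine ⟨Finset.mem_univ _, fun i hi => ?_⟩
    exact Finset.mem_symmDiff.2 (Or.inl ⟨hT.2 hi, Finset.notMem_singleton.2 fun h => hj (h ▸ hi)⟩)

theorem sum_superset_relSum (L : Finset (Fin k)) (u : PolyAlg k) :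
    ∑ T with L ⊆ T, relSum E T u = upSum E L (form L * u) := by
  simp_rw [relSum_apply]
  rw [Finset.sum_comm, form, Finset.sum_mul, map_sum,
    ← Finset.sum_subset (Finset.subset_univ L)]
  · refine Finset.sum_congr rfl fun j hj => ?_
    rw [upSum_apply]
    refine Finset.sum_congr rfl fun T hT => ?_
    rw [Finset.insert_eq_self.2 ((Finset.mem_filter.1 hT).2 hj)]
  · intro j _ hj
    exact sum_superset_insert_eq_zero hj fun T => E T (X j * u)

theorem upSum_form_mul (L : Finset (Fin k)) (u : PolyAlg k) :
    upSum E L (form L * u) = ∑ T with ¬L ⊆ T, relSum E T u := by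
  have htotal : ∑ T, relSum E T u = 0 := by
    simpa using sum_superset_relSum E ∅ u
  rw [← Finset.sum_filter_add_sum_filter_not _ (fun T => L ⊆ T), sum_superset_relSum] at htotal
  rw [eq_neg_of_add_eq_zero_left htotal, ZModModule.neg_eq_self]

theorem sum_Icc_const (S T : Finset (Fin k)) (v : V) :
    ∑ _L ∈ Finset.Icc S T, v = if S = T then v else 0 := by
  rw [Finset.sum_const]
  split_ifs with heq
  · rw [heq, Finset.Icc_self, Finset.card_singleton, one_smul]
  by_cases h : S ⊆ T
  · have hlt := Finset.card_lt_card (h.ssubset_of_ne heq)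
    rw [Finset.card_Icc_finset h, ← Nat.sub_add_cancel (Nat.sub_pos_of_lt hlt), pow_succ,
      mul_nsmul, two_nsmul, ZModModule.add_self]
  · rw [Finset.Icc_eq_empty h, Finset.card_empty, zero_nsmul]

/-- Möbius inversion over `𝔽₂` in the lattice of subsets. -/
theorem sum_eq_sum_upSum (y : Finset (Fin k) → PolyAlg k) :
    ∑ S, E S (y S) = ∑ L, upSum E L (∑ S with S ⊆ L, y S) := by
  calc ∑ T, E T (y T)
      = ∑ T, ∑ S, ∑ _L ∈ Finset.Icc S T, E T (y S) := by
        simp_rw [sum_Icc_const, Finset.sum_ite_eq', Finset.mem_univ, if_true]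
    _ = ∑ T, ∑ L with L ⊆ T, ∑ S with S ⊆ L, E T (y S) := by
        refine Finset.sum_congr rfl fun T _ => Finset.sum_comm' fun S L => ?_
        simp
    _ = ∑ L, ∑ T with L ⊆ T, ∑ S with S ⊆ L, E T (y S) :=
        Finset.sum_comm' fun T L => by simp
    _ = ∑ L, upSum E L (∑ S with S ⊆ L, y S) := by
        simp_rw [upSum_apply, map_sum]

theorem upSum_eq_zero {M : ℕ} (hE : ∀ S, ∀ y ∈ hitAt k M, E S y = 0) (L : Finset (Fin k))
    {y : PolyAlg k} (hy : y ∈ hitAt k M) : upSum E L y = 0 := by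
  rw [upSum_apply]
  exact Finset.sum_eq_zero fun S _ => hE S y hy

end SubsetFamily

section Extension

variable {k M : ℕ} {V : Type*} [AddCommGroup V] [Module (ZMod 2) V]

theorem exists_forall_apply_X_mul_eq (ρ : Fin k → PolyAlg k →ₗ[ZMod 2] V)
    (hρ : ∀ i j u, ρ i (X j * u) = ρ j (X i * u)) :
    ∃ σ : PolyAlg k →ₗ[ZMod 2] V, σ 1 = 0 ∧ ∀ i u, σ (X i * u) = ρ i u := by
  classical
  let v (c : Fin k →₀ ℕ) : V :=
    if h : ∃ i, c i ≠ 0 then ρ h.choose (monomial (c - Finsupp.single h.choose 1) 1) else 0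
  let σ : PolyAlg k →ₗ[ZMod 2] V := (basisMonomials (Fin k) (ZMod 2)).constr (ZMod 2) v
  have hσ (c) : σ (monomial c 1) = v c := by
    simpa only [coe_basisMonomials] using
      (basisMonomials (Fin k) (ZMod 2)).constr_basis (ZMod 2) v c
  have hmonomial (i c) : σ (X i * monomial c 1) = ρ i (monomial c 1) := by
    have h : ∃ j, (Finsupp.single i 1 + c : Fin k →₀ ℕ) j ≠ 0 := ⟨i, by simp⟩
    rw [← monomial_single_one_add, hσ, show v _ = _ from dif_pos h]
    have hj := h.choose_spec
    generalize h.choose = j at hj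
    rcases eq_or_ne i j with rfl | hij
    · rw [add_tsub_cancel_left]
    · have hcj : c j ≠ 0 := by simpa [Finsupp.single_eq_of_ne hij.symm] using hj
      obtain ⟨c', rfl⟩ := exists_add_of_le
        (Finsupp.single_le_iff.2 (Nat.one_le_iff_ne_zero.2 hcj))
      rw [add_left_comm, add_tsub_cancel_left, monomial_single_one_add, monomial_single_one_add,
        hρ]
  refine ⟨σ, ?_, fun i u => ?_⟩
  · rw [show (1 : PolyAlg k) = monomial 0 1 from rfl, hσ]
    exact dif_neg (by simp)
  · have h := map_mem_of_monomial (σ.comp (LinearMap.mulLeft (ZMod 2) (X i)) - ρ i) (W := ⊥)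
      (fun c => sub_eq_zero.2 (hmonomial i c)) u
    exact sub_eq_zero.1 h

theorem apply_eq_zero_of_mem_hitAt {σ : PolyAlg k →ₗ[ZMod 2] V} (hone : σ 1 = 0)
    (hX : ∀ i u, X i * u ∈ hitAt k M → σ (X i * u) = 0) {y : PolyAlg k} (hy : y ∈ hitAt k M) :
    σ y = 0 := by
  refine map_mem_of_mem_hitAt σ (W := ⊥) (fun g => ?_) (fun e he => ?_) hy
  · refine map_mem_of_monomial (σ.comp ((sqSum k).toLinearMap - LinearMap.id)) (fun e => ?_) g
    change σ (sqSum k (monomial e 1) - monomial e 1) = 0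
    induction e using exponent_induction with
    | zero => rw [show (monomial 0 1 : PolyAlg k) = 1 from rfl, map_one, sub_self, map_zero]
    | single_add i e _ =>
      have hfactor : sqSum k (X i * monomial e 1) - X i * monomial e 1 =
          X i * ((1 + X i) * sqSum k (monomial e 1) - monomial e 1) := by
        rw [map_mul, sqSum_X]
        ring
      rw [monomial_single_one_add, hfactor]
      exact hX _ _ (hfactor ▸ sqSum_sub_mem_hitAt M _)
  · rw [Submodule.mem_bot]
    induction e using exponent_induction with
    | zero => exact hone
    | single_add i e _ =>
      have hmem := monomial_mem_hitAt_of_degree_ne he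
      rw [monomial_single_one_add] at hmem ⊢
      exact hX _ _ hmem

end Extension

section Section

variable {q M : ℕ} {V : Type*} [AddCommGroup V] [Module (ZMod 2) V]
  {E : Finset (Fin (q + 1)) → PolyAlg (q + 1) →ₗ[ZMod 2] V}

theorem upSum_form_mul_eq_sum (hrel : ∀ T, T.card < q → relSum E T = 0)
    (L : Finset (Fin (q + 1))) (u : PolyAlg (q + 1)) :
    upSum E L (form L * u) = ∑ i ∈ L, relSum E {i}ᶜ u := by
  rw [upSum_form_mul]
  symm
  refine Finset.sum_of_injOn (fun i => {i}ᶜ)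
    (compl_injective.comp Finset.singleton_injective).injOn (fun i hi => ?_) (fun T hT hTL => ?_)
    fun i _ => rfl
  · simpa using hi
  · rcases card_lt_or_eq_compl_singleton_or_eq_univ T with hlt | ⟨j, rfl⟩ | rfl
    · rw [hrel T hlt, LinearMap.zero_apply]
    · exact absurd ⟨j, by simpa using hT, rfl⟩ hTL
    · simp at hT

theorem relSum_compl_singleton (hrel : ∀ T, T.card < q → relSum E T = 0) (i : Fin (q + 1))
    (u : PolyAlg (q + 1)) : relSum E {i}ᶜ u = upSum E {i} (X i * u) := by
  simpa using (upSum_form_mul_eq_sum hrel {i} u).symm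

theorem sum_relSum_compl_singleton_sqSum (hE : ∀ S, ∀ y ∈ hitAt (q + 1) M, E S y = 0)
    (hrel : ∀ T, T.card < q → relSum E T = 0) (L : Finset (Fin (q + 1))) (g : PolyAlg (q + 1)) :
    ∑ i ∈ L, relSum E {i}ᶜ (sqSum _ g + form L * sqSum _ g) = ∑ i ∈ L, relSum E {i}ᶜ g := by
  rw [← upSum_form_mul_eq_sum hrel, ← upSum_form_mul_eq_sum hrel, ← sub_eq_zero, ← map_sub]
  refine upSum_eq_zero E hE L ?_
  have hsq := sqSum_sub_mem_hitAt M (form L * g)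
  rw [map_mul, sqSum_form] at hsq
  convert hsq using 2
  ring

theorem relSum_compl_singleton_comm (hE : ∀ S, ∀ y ∈ hitAt (q + 1) M, E S y = 0)
    (hrel : ∀ T, T.card < q → relSum E T = 0) (i j : Fin (q + 1)) (u : PolyAlg (q + 1)) :
    relSum E {i}ᶜ (X j * u) = relSum E {j}ᶜ (X i * u) := by
  rcases eq_or_ne i j with rfl | hij
  · rfl
  let φ : PolyAlg (q + 1) →ₗ[ZMod 2] V :=
    (relSum E {i}ᶜ).comp (LinearMap.mulLeft (ZMod 2) (X j)) +
      (relSum E {j}ᶜ).comp (LinearMap.mulLeft (ZMod 2) (X i))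
  have hφ (u) : φ u = relSum E {i}ᶜ (X j * u) + relSum E {j}ᶜ (X i * u) := rfl
  suffices h : φ u ∈ (⊥ : Submodule (ZMod 2) V) by
    rwa [Submodule.mem_bot, hφ, ← ZModModule.sub_eq_add, sub_eq_zero] at h
  refine map_mem_of_sqSum φ (M - 2) (fun e he => ?_) (fun g => ?_) u
  · have hzero (a b : Fin (q + 1)) : relSum E {a}ᶜ (X b * monomial e 1) = 0 := by
      rw [relSum_compl_singleton hrel, ← monomial_single_one_add, ← monomial_single_one_add]
      refine upSum_eq_zero E hE _ (monomial_mem_hitAt_of_degree_ne ?_)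
      rw [map_add, map_add, Finsupp.degree_single, Finsupp.degree_single]
      omega
    rw [Submodule.mem_bot, hφ, hzero, hzero, add_zero]
  · have hi := sum_relSum_compl_singleton_sqSum hE hrel {i} g
    have hj := sum_relSum_compl_singleton_sqSum hE hrel {j} g
    have hsum := sum_relSum_compl_singleton_sqSum hE hrel {i, j} g
    simp only [form_singleton, form_pair hij, Finset.sum_singleton, Finset.sum_pair hij, add_mul,
      map_add] at hi hj hsum
    rw [← hi, ← hj, ← sub_eq_zero] at hsum
    rw [Submodule.mem_bot, hφ, ← hsum]
    abel

theorem exists_section (hE : ∀ S, ∀ y ∈ hitAt (q + 1) M, E S y = 0)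
    (hrel : ∀ T, T.card < q → relSum E T = 0) :
    ∃ σ : PolyAlg (q + 1) →ₗ[ZMod 2] V, (∀ y ∈ hitAt (q + 1) M, σ y = 0) ∧
      ∀ i u, σ (X i * u) = relSum E {i}ᶜ u := by
  obtain ⟨σ, hone, hσ⟩ := exists_forall_apply_X_mul_eq (fun i => relSum E {i}ᶜ)
    (relSum_compl_singleton_comm hE hrel)
  refine ⟨σ, fun y => apply_eq_zero_of_mem_hitAt hone fun i u hu => ?_, hσ⟩
  rw [hσ, relSum_compl_singleton hrel, upSum_eq_zero E hE _ hu]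

theorem exists_update_relSum_eq_zero (hE : ∀ S, ∀ y ∈ hitAt (q + 1) M, E S y = 0)
    (hrel : ∀ T, T.card < q → relSum E T = 0) (huniv : E Finset.univ = 0) :
    ∃ σ : PolyAlg (q + 1) →ₗ[ZMod 2] V, (∀ y ∈ hitAt (q + 1) M, σ y = 0) ∧
      ∀ T ≠ Finset.univ, relSum (Function.update E Finset.univ σ) T = 0 := by
  obtain ⟨σ, hσ, hX⟩ := exists_section hE hrel
  refine ⟨σ, hσ, fun T hT => LinearMap.ext fun u => ?_⟩
  rcases card_lt_or_eq_compl_singleton_or_eq_univ T with hlt | ⟨i, rfl⟩ | rfl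
  · rw [← hrel T hlt, relSum_apply, relSum_apply]
    refine Finset.sum_congr rfl fun j _ => ?_
    rw [Function.update_of_ne fun h => ?_]
    have := Finset.card_insert_le j T
    rw [h, Finset.card_fin] at this
    omega
  · have hinsert : insert i ({i}ᶜ : Finset (Fin (q + 1))) = Finset.univ := by
      rw [Finset.insert_eq, Finset.union_compl]
    have hrest : relSum E {i}ᶜ u =
        ∑ j ∈ Finset.univ.erase i, E (insert j {i}ᶜ) (X j * u) := by
      rw [relSum_apply, ← Finset.add_sum_erase _ _ (Finset.mem_univ i), hinsert, huniv,
        LinearMap.zero_apply, zero_add]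
    rw [relSum_apply, ← Finset.add_sum_erase _ _ (Finset.mem_univ i), hinsert,
      Function.update_self, hX, hrest, LinearMap.zero_apply, ← Finset.sum_add_distrib]
    refine Finset.sum_eq_zero fun j hj => ?_
    have hji : insert j ({i}ᶜ : Finset (Fin (q + 1))) = {i}ᶜ :=
      Finset.insert_eq_self.2 (by simpa using hj)
    rw [Function.update_of_ne (by rw [hji]; simp), ZModModule.add_self]
  · exact absurd rfl hT

end Section

section LiftFamily

variable {q M d : ℕ}

theorem SparseHitTower.exists_liftFamily (hM : SparseHitTower q M) (hd : q ≤ d) :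
    ∃ E : Finset (Fin (q + 1)) →
        PolyAlg (q + 1) →ₗ[ZMod 2] PolyAlg (q + 1) ⧸ hitAt (q + 1) (liftDegree q M d),
      (∀ S, ∀ y ∈ hitAt (q + 1) M, E S y = 0) ∧ (∀ T ≠ Finset.univ, relSum E T = 0) ∧
      ∀ S, S.card ≤ d → E S = (hitAt (q + 1) (liftDegree q M d)).mkQ ∘ₗ setLift d S := by
  let E (S : Finset (Fin (q + 1))) :
      PolyAlg (q + 1) →ₗ[ZMod 2] PolyAlg (q + 1) ⧸ hitAt (q + 1) (liftDegree q M d) :=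
    if S.card ≤ d then (hitAt (q + 1) (liftDegree q M d)).mkQ ∘ₗ setLift d S else 0
  have hcard (S) (hS : S.card ≤ d) :
      E S = (hitAt (q + 1) (liftDegree q M d)).mkQ ∘ₗ setLift d S := if_pos hS
  have hE (S) (y) (hy : y ∈ hitAt (q + 1) M) : E S y = 0 := by
    by_cases hS : S.card ≤ d
    · rw [hcard S hS]
      exact (Submodule.Quotient.mk_eq_zero _).2 (hM.setLift_mem_hitAt hS hy)
    · rw [show E S = 0 from if_neg hS, LinearMap.zero_apply]
  have hrel (T : Finset (Fin (q + 1))) (hT : T.card < d) : relSum E T = 0 := by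
    refine LinearMap.ext fun u => ?_
    have h := (Submodule.Quotient.mk_eq_zero _).2 (hM.varSum_setLift_insert_mem_hitAt hT u)
    rw [varSum_apply, ← Submodule.mkQ_apply, map_sum] at h
    rw [relSum_apply, LinearMap.zero_apply, ← h]
    refine Finset.sum_congr rfl fun j _ => ?_
    rw [hcard _ ((Finset.card_insert_le j T).trans hT), LinearMap.comp_apply]
  rcases hd.eq_or_lt with rfl | hlt
  · have hfull : ¬(Finset.univ : Finset (Fin (q + 1))).card ≤ q := by simp
    obtain ⟨σ, hσ, hrelσ⟩ := exists_update_relSum_eq_zero hE hrel (if_neg hfull)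
    refine ⟨Function.update E Finset.univ σ, fun S y hy => ?_, hrelσ, fun S hS => ?_⟩
    · rcases eq_or_ne S Finset.univ with rfl | hne
      · rw [Function.update_self, hσ y hy]
      · rw [Function.update_of_ne hne, hE S y hy]
    · rw [Function.update_of_ne (by rintro rfl; exact hfull hS), hcard S hS]
  · refine ⟨E, hE, fun T hT => hrel T ?_, hcard⟩
    have := Finset.card_lt_card (Finset.ssubset_univ_iff.2 hT)
    rw [Finset.card_fin] at this
    omega

theorem SparseHitTower.sum_setLift_mem_hitAt (hM : SparseHitTower q M) (hd : q ≤ d)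
    {y : Finset (Fin (q + 1)) → PolyAlg (q + 1)} (hy : ∀ S, d < S.card → y S = 0)
    (hform : ∀ L, ∃ u, ∑ S with S ⊆ L, y S - form L * u ∈ hitAt (q + 1) M) :
    ∑ S, setLift d S (y S) ∈ hitAt (q + 1) (liftDegree q M d) := by
  obtain ⟨E, hE, hrel, hcard⟩ := hM.exists_liftFamily hd
  have hsum : ∑ S, E S (y S) = 0 := by
    rw [sum_eq_sum_upSum]
    refine Finset.sum_eq_zero fun L _ => ?_
    obtain ⟨u, hu⟩ := hform L
    have hL := upSum_eq_zero E hE L hu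
    rw [map_sub, sub_eq_zero] at hL
    rw [hL, upSum_form_mul]
    refine Finset.sum_eq_zero fun T hT => ?_
    rw [hrel T (by rintro rfl; simp at hT), LinearMap.zero_apply]
  rw [← Submodule.Quotient.mk_eq_zero, ← Submodule.mkQ_apply, map_sum, ← hsum]
  refine Finset.sum_congr rfl fun S _ => ?_
  rcases le_or_gt S.card d with hS | hS
  · rw [hcard S hS, LinearMap.comp_apply]
  · rw [hy S hS, map_zero, map_zero, map_zero]

end LiftFamily

section LinearSubstitution

variable {a b N : ℕ} {φ : PolyAlg a →ₐ[ZMod 2] PolyAlg b}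

theorem algHom_sqSum (hφ : ∀ j, ∃ L, φ (X j) = form L) (f : PolyAlg a) :
    φ (sqSum a f) = sqSum b (φ f) := by
  suffices h : φ.comp (sqSum a) = (sqSum b).comp φ from AlgHom.congr_fun h f
  refine algHom_ext fun j => ?_
  obtain ⟨L, hL⟩ := hφ j
  simp only [AlgHom.comp_apply, sqSum_X, map_add, map_pow, hL, sqSum_form]

theorem algHom_monomial_mem_degreeIn (hφ : ∀ j, ∃ L, φ (X j) = form L) (e : Fin a →₀ ℕ) :
    φ (monomial e 1) ∈ degreeIn b {e.degree} := by
  induction e using exponent_induction with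
  | zero =>
    rw [show (monomial 0 1 : PolyAlg a) = 1 from rfl, map_one]
    exact one_mem_degreeIn (by simp)
  | single_add j e ih =>
    obtain ⟨L, hL⟩ := hφ j
    have hform : form L ∈ degreeIn b {1} := Submodule.sum_mem _ fun i _ => X_mem_degreeIn i
    rw [monomial_single_one_add, map_mul, hL, map_add, Finsupp.degree_single]
    exact mul_mem_degreeIn hform ih (by simp)

theorem algHom_mem_hitAt (hφ : ∀ j, ∃ L, φ (X j) = form L) {f : PolyAlg a}
    (hf : f ∈ hitAt a N) : φ f ∈ hitAt b N := by
  refine map_mem_of_mem_hitAt φ.toLinearMap (W := hitAt b N) (fun g => ?_) (fun e he => ?_) hf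
  · rw [AlgHom.toLinearMap_apply, map_sub, algHom_sqSum hφ]
    exact sqSum_sub_mem_hitAt N _
  · exact mem_hitAt_of_ne (algHom_monomial_mem_degreeIn hφ e) he

end LinearSubstitution

section Restriction

variable {q N : ℕ} {p : Fin (q + 1)} {L : Finset (Fin (q + 1))}

/-- The restriction of polynomials to the hyperplane `∑_{j ∈ L} x_j = 0`, where `p ∈ L` and the
variables other than `x_p` serve as coordinates of the hyperplane. -/
noncomputable def restrict (p : Fin (q + 1)) (L : Finset (Fin (q + 1))) :
    PolyAlg (q + 1) →ₐ[ZMod 2] PolyAlg q :=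
  aeval (p.insertNth (α := fun _ => PolyAlg q) (form {i | p.succAbove i ∈ L}) X)

@[simp] theorem restrict_X_self (p : Fin (q + 1)) (L : Finset (Fin (q + 1))) :
    restrict p L (X p) = form {i | p.succAbove i ∈ L} := by
  rw [restrict, aeval_X, Fin.insertNth_apply_same]

@[simp] theorem restrict_X_succAbove (p : Fin (q + 1)) (L : Finset (Fin (q + 1))) (i : Fin q) :
    restrict p L (X (p.succAbove i)) = X i := by
  rw [restrict, aeval_X, Fin.insertNth_apply_succAbove]

theorem restrict_rename (p : Fin (q + 1)) (L : Finset (Fin (q + 1))) (y : PolyAlg q) :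
    restrict p L (rename p.succAbove y) = y := by
  suffices h : (restrict p L).comp (rename p.succAbove) = AlgHom.id _ _ from AlgHom.congr_fun h y
  exact algHom_ext fun i => by simp

theorem restrict_singleton_X {j : Fin (q + 1)} (hp : p ∈ ({j} : Finset (Fin (q + 1)))) :
    restrict p {j} (X j) = 0 := by
  obtain rfl := Finset.mem_singleton.1 hp
  simp [Fin.succAbove_ne]

theorem restrict_mem_hitAt (p : Fin (q + 1)) (L : Finset (Fin (q + 1))) {f : PolyAlg (q + 1)}
    (hf : f ∈ hitAt (q + 1) N) : restrict p L f ∈ hitAt q N := by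
  refine algHom_mem_hitAt (fun j => ?_) hf
  rcases Fin.eq_self_or_eq_succAbove p j with rfl | ⟨i, rfl⟩
  · exact ⟨_, restrict_X_self j L⟩
  · exact ⟨{i}, by simp⟩

theorem rename_mem_hitAt (p : Fin (q + 1)) {f : PolyAlg q} (hf : f ∈ hitAt q N) :
    rename p.succAbove f ∈ hitAt (q + 1) N :=
  algHom_mem_hitAt (fun j => ⟨{p.succAbove j}, by simp⟩) hf

theorem X_add_rename_form (hp : p ∈ L) :
    X p + rename p.succAbove (form {i | p.succAbove i ∈ L}) = form L := by
  rw [form, form, ← Finset.sum_ite_mem_eq L, Fin.sum_univ_succAbove _ p, if_pos hp, map_sum,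
    Finset.sum_filter]
  simp only [rename_X]

theorem form_dvd_sub_rename_restrict (hp : p ∈ L) (f : PolyAlg (q + 1)) :
    form L ∣ f - rename p.succAbove (restrict p L f) := by
  let π := Ideal.Quotient.mkₐ (ZMod 2) (Ideal.span {form L})
  have hform : π (form L) = 0 :=
    Ideal.Quotient.eq_zero_iff_mem.2 (Ideal.mem_span_singleton_self _)
  suffices h : π = π.comp ((rename p.succAbove).comp (restrict p L)) by
    rw [← Ideal.mem_span_singleton, ← Ideal.Quotient.eq_zero_iff_mem]
    exact (map_sub π _ _).trans (sub_eq_zero.2 (AlgHom.congr_fun h f))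
  refine algHom_ext fun j => ?_
  rcases Fin.eq_self_or_eq_succAbove p j with rfl | ⟨i, rfl⟩
  · rw [AlgHom.comp_apply, AlgHom.comp_apply, restrict_X_self, ← sub_eq_zero, ← map_sub,
      ZModModule.sub_eq_add, X_add_rename_form hp, hform]
  · simp

theorem exists_sub_form_mul_mem_hitAt (hp : p ∈ L) {w : PolyAlg (q + 1)}
    (hw : restrict p L w ∈ hitAt q N) : ∃ u, w - form L * u ∈ hitAt (q + 1) N := by
  obtain ⟨u, hu⟩ := form_dvd_sub_rename_restrict hp w
  refine ⟨u, ?_⟩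
  rw [← hu, sub_sub_cancel]
  exact rename_mem_hitAt p hw

theorem restrict_varProd (p : Fin (q + 1)) (L S : Finset (Fin (q + 1))) :
    restrict p L (varProd S) =
      (if p ∈ S then form {i | p.succAbove i ∈ L} else 1) * varProd {i | p.succAbove i ∈ S} := by
  rw [varProd, varProd, ← Finset.prod_ite_mem_eq S, Fin.prod_univ_succAbove _ p, map_mul, map_prod,
    Finset.prod_filter]
  simp [apply_ite (restrict p L)]

end Restriction

section Kameko

variable {q M d : ℕ}

/-- Kameko's map, which sends `x₁ ⋯ x_q y²` to `y` and kills the monomials with an even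
exponent. -/
noncomputable def kameko (q : ℕ) : PolyAlg q →ₗ[ZMod 2] PolyAlg q :=
  (basisMonomials (Fin q) (ZMod 2)).constr (ZMod 2) fun e =>
    if ∀ i, Odd (e i) then monomial (e.mapRange (· / 2) rfl) 1 else 0

theorem kameko_monomial (e : Fin q →₀ ℕ) :
    kameko q (monomial e 1) =
      if ∀ i, Odd (e i) then monomial (e.mapRange (· / 2) rfl) 1 else 0 := by
  have h := (basisMonomials (Fin q) (ZMod 2)).constr_basis (ZMod 2) (fun e =>
    if ∀ i, Odd (e i) then (monomial (e.mapRange (· / 2) rfl) 1 : PolyAlg q) else 0) e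
  rwa [coe_basisMonomials] at h

theorem mulSq_varProd_monomial (s : Finset (Fin q)) (e : Fin q →₀ ℕ) :
    mulSq (varProd s) (monomial e 1) = monomial (∑ j ∈ s, Finsupp.single j 1 + 2 • e) 1 := by
  rw [mulSq_apply, monomial_one_sq, varProd, ← one_mul (1 : ZMod 2), ← monomial_mul,
    monomial_sum_one, one_mul]
  rfl

theorem kameko_mulSq_varProd (s : Finset (Fin q)) (y : PolyAlg q) :
    kameko q (mulSq (varProd s) y) = if s = Finset.univ then y else 0 := by
  suffices h : ∀ e : Fin q →₀ ℕ, kameko q (mulSq (varProd s) (monomial e 1)) =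
      if s = Finset.univ then monomial e 1 else 0 by
    have hzero := map_mem_of_monomial (W := ⊥) ((kameko q).comp (mulSq (varProd s)) -
      (if s = Finset.univ then LinearMap.id else 0)) (fun e => ?_) y
    · rw [Submodule.mem_bot, LinearMap.sub_apply, sub_eq_zero] at hzero
      rw [← LinearMap.comp_apply, hzero]
      split_ifs <;> rfl
    · rw [Submodule.mem_bot, LinearMap.sub_apply, LinearMap.comp_apply, h, sub_eq_zero]
      split_ifs <;> rfl
  intro e
  rw [mulSq_varProd_monomial]
  set E : Fin q →₀ ℕ := ∑ j ∈ s, Finsupp.single j 1 + 2 • e with hE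
  have hexp (i) : E i = (if i ∈ s then 1 else 0) + 2 * e i := by
    simp [hE, Finsupp.single_apply]
  have hodd : (∀ i, Odd (E i)) ↔ s = Finset.univ := by
    rw [Finset.eq_univ_iff_forall]
    refine forall_congr' fun i => ?_
    rw [hexp]
    split_ifs with hi <;> simp [hi]
  rw [kameko_monomial, if_congr hodd rfl rfl]
  split_ifs with hs
  · refine congrArg (monomial · 1) (Finsupp.ext fun i => ?_)
    rw [Finsupp.mapRange_apply, hexp, hs, if_pos (Finset.mem_univ i)]
    omega
  · rfl

theorem kameko_sqSum (f : PolyAlg q) : kameko q (sqSum q f) = sqSum q (kameko q f) := by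
  have h := map_mem_of_monomial (W := ⊥) ((kameko q).comp (sqSum q).toLinearMap -
    (sqSum q).toLinearMap.comp (kameko q)) (fun e => ?_) f
  · exact sub_eq_zero.1 h
  obtain ⟨s, e', he⟩ := exists_monomial_eq_mulSq_varProd e
  rw [he]
  change kameko q (sqSum q _) - sqSum q (kameko q _) = 0
  rw [sub_eq_zero, sqSum_mulSq_varProd, map_sum]
  simp_rw [kameko_mulSq_varProd]
  rw [Finset.sum_ite_eq']
  by_cases hs : s = Finset.univ
  · simp [hs]
  · rw [if_neg, if_neg hs, map_zero]
    rwa [Finset.mem_powerset, Finset.univ_subset_iff]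

theorem kameko_mem_hitAt {f : PolyAlg q} (hf : f ∈ hitAt q (2 * M + q)) :
    kameko q f ∈ hitAt q M := by
  refine map_mem_of_mem_hitAt (kameko q) (W := hitAt q M) (fun g => ?_) (fun e he => ?_) hf
  · rw [map_sub, kameko_sqSum]
    exact sqSum_sub_mem_hitAt M _
  · obtain ⟨s, e', rfl⟩ : ∃ (s : Finset (Fin q)) (e' : Fin q →₀ ℕ),
        e = ∑ j ∈ s, Finsupp.single j 1 + 2 • e' := by
      obtain ⟨s, e', h⟩ := exists_monomial_eq_mulSq_varProd e
      rw [mulSq_varProd_monomial] at h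
      exact ⟨s, e', monomial_left_injective one_ne_zero h⟩
    rw [← mulSq_varProd_monomial, kameko_mulSq_varProd]
    split_ifs with hs
    · refine monomial_mem_hitAt_of_degree_ne ?_
      rintro rfl
      simp [hs, add_comm] at he
    · exact zero_mem _

theorem kameko_pow_mem_hitAt {f : PolyAlg q} (hf : f ∈ hitAt q (liftDegree q M d)) :
    (kameko q ^ d) f ∈ hitAt q M := by
  induction d generalizing f with
  | zero => exact hf
  | succ d ih =>
    rw [pow_succ, Module.End.mul_apply]
    exact ih (kameko_mem_hitAt hf)

theorem kameko_X_mul_mulSq_varProd_compl (i j : Fin q) (y : PolyAlg q) :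
    kameko q (X i * mulSq (varProd {j}ᶜ) y) = if i = j then y else 0 := by
  split_ifs with h
  · subst h
    have huniv : X i * varProd {i}ᶜ = (varProd Finset.univ : PolyAlg q) := by
      rw [Finset.compl_singleton, X_mul_varProd_erase (Finset.mem_univ i)]
    rw [mulSq_apply, ← mul_assoc, huniv, ← mulSq_apply, kameko_mulSq_varProd, if_pos rfl]
  · have hi : i ∈ ({j}ᶜ : Finset (Fin q)) := by simpa using h
    rw [mulSq_apply, ← mul_assoc, X_mul_varProd hi, mul_assoc, ← mul_pow, ← mulSq_apply,
      kameko_mulSq_varProd, if_neg fun h => Finset.notMem_erase i _ (h ▸ Finset.mem_univ i)]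

theorem kameko_restrict_lift {p : Fin (q + 1)} {L : Finset (Fin (q + 1))} (hp : p ∈ L)
    (j : Fin (q + 1)) (y : PolyAlg (q + 1)) :
    kameko q (restrict p L (lift j y)) = if j ∈ L then restrict p L y else 0 := by
  rw [lift, mulSq_apply, map_mul, map_pow, restrict_varProd]
  rcases Fin.eq_self_or_eq_succAbove p j with rfl | ⟨j, rfl⟩
  · have huniv : ({i | j.succAbove i ∈ ({j}ᶜ : Finset (Fin (q + 1)))} : Finset (Fin q)) =
        Finset.univ := by
      ext i
      simp [Fin.succAbove_ne]
    rw [if_neg (by simp), one_mul, huniv, ← mulSq_apply, kameko_mulSq_varProd, if_pos rfl,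
      if_pos hp]
  · have hcompl : ({i | p.succAbove i ∈ ({p.succAbove j}ᶜ : Finset (Fin (q + 1)))} :
        Finset (Fin q)) = {j}ᶜ := by
      ext i
      simp
    rw [if_pos (by simp), hcompl, mul_assoc, ← mulSq_apply,
      form, Finset.sum_mul, map_sum]
    simp_rw [kameko_X_mul_mulSq_varProd_compl]
    simp

theorem kameko_pow_restrict_lifts {p : Fin (q + 1)} {L : Finset (Fin (q + 1))} (hp : p ∈ L)
    (J : List (Fin (q + 1))) (y : PolyAlg (q + 1)) :
    (kameko q ^ J.length) (restrict p L (lifts J y)) =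
      if J.toFinset ⊆ L then restrict p L y else 0 := by
  induction J with
  | nil => simp
  | cons j J ih =>
    rw [List.length_cons, pow_succ, Module.End.mul_apply, lifts_cons, kameko_restrict_lift hp]
    by_cases hj : j ∈ L <;> simp [hj, ih, Finset.insert_subset_iff]

end Kameko

section Descent

variable {q M d : ℕ}

/-- Restriction to the hyperplane `∑_{j ∈ L} x_j = 0` followed by the `d`-fold Kameko map. The
variable eliminated in the restriction is the first one in `L`. -/
noncomputable def descent (d : ℕ) (L : {L : Finset (Fin (q + 1)) // L.Nonempty}) :
    PolyAlg (q + 1) →ₗ[ZMod 2] PolyAlg q :=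
  (kameko q ^ d) ∘ₗ (restrict (L.1.min' L.2) L.1).toLinearMap

theorem descent_setLift (L : {L : Finset (Fin (q + 1)) // L.Nonempty})
    {S : Finset (Fin (q + 1))} (hne : S.Nonempty) (hcard : S.card ≤ d) (y : PolyAlg (q + 1)) :
    descent d L (setLift d S y) = if S ⊆ L then restrict (L.1.min' L.2) L.1 y else 0 := by
  have h := kameko_pow_restrict_lifts (L.1.min'_mem L.2) (padList d S) y
  rwa [length_padList hcard, toFinset_padList hne] at h

theorem descent_mem_hitAt (L : {L : Finset (Fin (q + 1)) // L.Nonempty}) {f : PolyAlg (q + 1)}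
    (hf : f ∈ hitAt (q + 1) (liftDegree q M d)) : descent d L f ∈ hitAt q M :=
  kameko_pow_mem_hitAt (restrict_mem_hitAt _ _ hf)

theorem SparseHitTower.mem_hitAt_of_descent_mem_hitAt (hM : SparseHitTower q M) (hq : 0 < q)
    (hd : q ≤ d) {f : PolyAlg (q + 1)} (hf : ∀ L, descent d L f ∈ hitAt q M) :
    f ∈ hitAt (q + 1) (liftDegree q M d) := by
  obtain ⟨y, hy, hfy⟩ := hM.exists_modEq_sum_setLift (hq.trans_le hd) f
  rw [SModEq.sub_mem] at hfy
  suffices h : ∑ S, setLift d S (y S) ∈ hitAt (q + 1) (liftDegree q M d) from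
    (Submodule.sub_mem_iff_left _ h).1 hfy
  refine hM.sum_setLift_mem_hitAt hd (fun S hS => hy S fun h => hS.not_ge h.2) fun L => ?_
  rcases L.eq_empty_or_nonempty with rfl | hL
  · refine ⟨0, ?_⟩
    simp [Finset.filter_eq', Finset.subset_empty, hy ∅ (by simp)]
  · refine exists_sub_form_mul_mem_hitAt (L.min'_mem hL) ?_
    have hterm (S : Finset (Fin (q + 1))) : descent d ⟨L, hL⟩ (setLift d S (y S)) =
        if S ⊆ L then restrict (L.min' hL) L (y S) else 0 := by
      by_cases hS : S.Nonempty ∧ S.card ≤ d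
      · exact descent_setLift _ hS.1 hS.2 _
      · simp [hy S hS]
    have hsum := descent_mem_hitAt ⟨L, hL⟩ hfy
    rw [map_sub, map_sum, Submodule.sub_mem_iff_right _ (hf ⟨L, hL⟩)] at hsum
    simpa only [hterm, map_sum, ← Finset.sum_filter] using hsum

end Descent

section DescentPi

variable {q M d : ℕ}

/-- All the maps `descent d L` together, with values in classes of degree `M`. -/
noncomputable def descentPi (q M d : ℕ) : PolyAlg (q + 1) →ₗ[ZMod 2]
    {L : Finset (Fin (q + 1)) // L.Nonempty} → PolyAlg q ⧸ hitAt q M :=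
  LinearMap.pi fun L => (hitAt q M).mkQ ∘ₗ descent d L

theorem SparseHitTower.ker_descentPi (hM : SparseHitTower q M) (hq : 0 < q) (hd : q ≤ d) :
    LinearMap.ker (descentPi q M d) = hitAt (q + 1) (liftDegree q M d) := by
  ext f
  have hmem : f ∈ LinearMap.ker (descentPi q M d) ↔ ∀ L, descent d L f ∈ hitAt q M := by
    rw [LinearMap.mem_ker, funext_iff]
    exact forall_congr' fun L => Submodule.Quotient.mk_eq_zero _
  exact hmem.trans ⟨hM.mem_hitAt_of_descent_mem_hitAt hq hd, fun hf L => descent_mem_hitAt L hf⟩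

/-- The sum of the lifts `setLift d S` over `L ⊆ S ⊂ {1, …, q + 1}`. Since `Finset.Icc L L'` has an
even number of elements unless `L = L'`, descent to `L'` almost isolates `L' = L`. -/
noncomputable def upLift (d : ℕ) (L : Finset (Fin (q + 1))) :
    PolyAlg (q + 1) →ₗ[ZMod 2] PolyAlg (q + 1) :=
  ∑ S ∈ Finset.Ico L Finset.univ, setLift d S

theorem descent_upLift (hd : q ≤ d) (L' : {L : Finset (Fin (q + 1)) // L.Nonempty})
    {L : Finset (Fin (q + 1))} (hL : L.Nonempty) (w : PolyAlg (q + 1)) :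
    descent d L' (upLift d L w) = (if L = L' then restrict (L'.1.min' L'.2) L'.1 w else 0) +
      if L'.1 = Finset.univ then restrict (L'.1.min' L'.2) L'.1 w else 0 := by
  set v := restrict (L'.1.min' L'.2) L'.1 w
  have hterm : ∀ S ∈ Finset.Ico L Finset.univ,
      descent d L' (setLift d S w) = if S ⊆ L' then v else 0 := by
    intro S hS
    obtain ⟨hLS, hS⟩ := Finset.mem_Ico.1 hS
    have hcard : S.card < q + 1 := by simpa using Finset.card_lt_card hS
    exact descent_setLift L' (hL.mono hLS) (by omega) w
  have hIcc : Finset.filter (· ⊆ L'.1) (Finset.Icc L Finset.univ) = Finset.Icc L L' := by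
    ext S
    simp
  have hsum : ∑ S ∈ Finset.Icc L Finset.univ, (if S ⊆ L' then v else 0) =
      if L = L' then v else 0 := by
    rw [← Finset.sum_filter, hIcc, sum_Icc_const]
  rw [upLift, LinearMap.sum_apply, map_sum, Finset.sum_congr rfl hterm, ← hsum,
    ← Finset.sum_Ico_add_eq_sum_Icc (Finset.subset_univ L), add_assoc]
  simp [Finset.univ_subset_iff, ZModModule.add_self]

theorem descent_upLift_add_upLift_rename (hd : q ≤ d)
    (L L' : {L : Finset (Fin (q + 1)) // L.Nonempty}) (i : Fin q) (c : PolyAlg q) {p : Fin (q + 1)}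
    (hp : p = L.1.min' L.2) :
    descent d L' ((upLift d L.1 + upLift d {p.succAbove i}) (rename p.succAbove (X i * c))) =
      if L = L' then X i * c else 0 := by
  have hsingleton (hL' : {p.succAbove i} = L'.1) :
      restrict (L'.1.min' L'.2) L'.1 (rename p.succAbove (X i * c)) = 0 := by
    obtain ⟨_, h⟩ := L'
    subst hL'
    rw [map_mul, rename_X, map_mul, restrict_singleton_X (Finset.min'_mem _ h), zero_mul]
  rw [LinearMap.add_apply, map_add, descent_upLift hd L' L.2,
    descent_upLift hd L' (Finset.singleton_nonempty _), ite_eq_right_iff.2 hsingleton, zero_add,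
    add_assoc, ZModModule.add_self, add_zero]
  refine if_ctx_congr Subtype.ext_iff.symm (fun h => ?_) fun _ => rfl
  rw [← h, ← hp, restrict_rename]

theorem exists_descentPi_eq_single (hd : q ≤ d) (hM : 0 < M)
    (L : {L : Finset (Fin (q + 1)) // L.Nonempty}) (z : PolyAlg q) :
    ∃ g, descentPi q M d g = Pi.single L ((hitAt q M).mkQ z) := by
  refine map_mem_of_monomial (LinearMap.single (ZMod 2) (fun _ => PolyAlg q ⧸ hitAt q M) L ∘ₗ
    (hitAt q M).mkQ) (W := LinearMap.range (descentPi q M d)) (fun e => ?_) z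
  rw [LinearMap.comp_apply]
  by_cases he : e.degree = M
  · obtain ⟨i, hi⟩ : ∃ i, e i ≠ 0 := by
      by_contra! h
      obtain rfl : e = 0 := Finsupp.ext h
      simp [← he] at hM
    have hz : (monomial e 1 : PolyAlg q) = X i * monomial (e - Finsupp.single i 1) 1 := by
      rw [← monomial_single_one_add, add_tsub_cancel_of_le]
      simpa [Nat.one_le_iff_ne_zero] using hi
    refine ⟨(upLift d L.1 + upLift d {(L.1.min' L.2).succAbove i})
      (rename (L.1.min' L.2).succAbove (monomial e 1)), funext fun L' => ?_⟩
    rw [hz, descentPi, LinearMap.pi_apply, LinearMap.comp_apply,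
      descent_upLift_add_upLift_rename hd L L' i _ rfl, LinearMap.single_apply, Pi.single_apply]
    simp only [eq_comm, apply_ite (hitAt q M).mkQ, map_zero]
  · rw [Submodule.mkQ_apply, (Submodule.Quotient.mk_eq_zero _).2
      (monomial_mem_hitAt_of_degree_ne he), map_zero]
    exact zero_mem _

theorem descentPi_surjective (hd : q ≤ d) (hM : 0 < M) :
    Function.Surjective (descentPi q M d) := by
  intro x
  have hsingle (L) : ∃ g, descentPi q M d g = Pi.single L (x L) := by
    obtain ⟨z, hz⟩ := (hitAt q M).mkQ_surjective (x L)
    exact hz ▸ exists_descentPi_eq_single hd hM L z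
  choose g hg using hsingle
  exact ⟨∑ L, g L, by rw [map_sum, Finset.sum_congr rfl fun L _ => hg L, Finset.univ_sum_single]⟩

theorem card_nonempty_finset (k : ℕ) :
    Fintype.card {L : Finset (Fin k) // L.Nonempty} = 2 ^ k - 1 := by
  simp_rw [Finset.nonempty_iff_ne_empty]
  rw [Fintype.card_subtype_compl]
  simp

theorem SparseHitTower.finrank_QPdeg_liftDegree (hM : SparseHitTower q M) (hq : 0 < q)
    (hd : q ≤ d) (hM0 : 0 < M) :
    Module.finrank (ZMod 2) (QPdeg (q + 1) (liftDegree q M d)) =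
      (2 ^ (q + 1) - 1) * Module.finrank (ZMod 2) (QPdeg q M) := by
  have e := (quotHitAtEquiv (q + 1) (liftDegree q M d)).symm.trans <|
    (Submodule.quotEquivOfEq _ _ (hM.ker_descentPi hq hd).symm).trans <|
      ((descentPi q M d).quotKerEquivOfSurjective (descentPi_surjective hd hM0)).trans <|
        LinearEquiv.piCongrRight fun _ => quotHitAtEquiv q M
  rw [e.finrank_eq, Module.finrank_pi_fintype, Finset.sum_const, Finset.card_univ,
    card_nonempty_finset, smul_eq_mul]

end DescentPi

section DescendingExponents

variable {q : ℕ} {d : ℕ → ℕ}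

theorem sum_two_pow_sub_one_add_card (s : Finset ℕ) (e : ℕ → ℕ) :
    ∑ i ∈ s, (2 ^ e i - 1) + s.card = ∑ i ∈ s, 2 ^ e i := by
  rw [Finset.card_eq_sum_ones, ← Finset.sum_add_distrib]
  exact Finset.sum_congr rfl fun i _ => Nat.sub_add_cancel Nat.one_le_two_pow

theorem strictAntiOn_of_descending (hd : ∀ i, 1 ≤ i → i < q - 1 → d (i + 1) < d i) :
    StrictAntiOn d (Set.Icc 1 (q - 1)) :=
  strictAntiOn_of_add_one_lt Set.ordConnected_Icc fun i _ hi hi' => hd i hi.1 hi'.2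

theorem le_of_descending (hd : ∀ i, 1 ≤ i → i < q - 1 → d (i + 1) < d i) (hq : d q ≤ d (q - 1))
    {i : ℕ} (hi : i ∈ Set.Icc 1 (q - 1)) : d q ≤ d i :=
  hq.trans <| (strictAntiOn_of_descending hd).antitoneOn hi ⟨hi.1.trans hi.2, le_rfl⟩ hi.2

theorem sum_two_pow_sub_one_pos_of_descending
    (hd : ∀ i, 1 ≤ i → i < q - 1 → d (i + 1) < d i) (hq : d q ≤ d (q - 1)) (h3 : 3 ≤ q) :
    0 < ∑ i ∈ Finset.Icc 1 (q - 1), (2 ^ (d i - d q) - 1) := by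
  have hlt : d q < d 1 :=
    (le_of_descending hd hq ⟨one_le_two, by omega⟩).trans_lt (hd 1 le_rfl (by omega))
  exact Finset.sum_pos' (fun _ _ => Nat.zero_le _) ⟨1, Finset.mem_Icc.2 ⟨le_rfl, by omega⟩,
    Nat.sub_pos_of_lt (Nat.one_lt_two_pow (Nat.sub_ne_zero_of_lt hlt))⟩

theorem binaryWeight_sum_of_descending (hd : ∀ i, 1 ≤ i → i < q - 1 → d (i + 1) < d i)
    (hq : d q ≤ d (q - 1)) (hpos : 0 < q) :
    binaryWeight (∑ i ∈ Finset.Icc 1 (q - 1), (2 ^ (d i - d q) - 1) + q - 1) = q - 1 := by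
  have hinj : Set.InjOn (fun i => d i - d q) (Finset.Icc 1 (q - 1)) := by
    rw [Finset.coe_Icc]
    exact fun i hi j hj h => (strictAntiOn_of_descending hd).injOn hi hj
      ((tsub_left_inj (le_of_descending hd hq hi) (le_of_descending hd hq hj)).1 h)
  have hsum := sum_two_pow_sub_one_add_card (Finset.Icc 1 (q - 1)) fun i => d i - d q
  rw [Nat.card_Icc, Nat.add_sub_cancel] at hsum
  rw [Nat.add_sub_assoc hpos, hsum, ← Finset.sum_image (f := (2 ^ ·)) hinj,
    binaryWeight_sum_two_pow, Finset.card_image_of_injOn hinj, Nat.card_Icc, Nat.add_sub_cancel]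

theorem sum_two_pow_sub_one_add_of_descending
    (hd : ∀ i, 1 ≤ i → i < q - 1 → d (i + 1) < d i) (hq : d q ≤ d (q - 1)) (hpos : 0 < q) :
    ∑ i ∈ Finset.Icc 1 q, (2 ^ d i - 1) + q =
      2 ^ d q * (∑ i ∈ Finset.Icc 1 (q - 1), (2 ^ (d i - d q) - 1) + q) := by
  obtain ⟨r, rfl⟩ := Nat.exists_eq_add_one.2 hpos
  have hn := sum_two_pow_sub_one_add_card (Finset.Icc 1 (r + 1)) d
  have hm := sum_two_pow_sub_one_add_card (Finset.Icc 1 r) fun i => d i - d (r + 1)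
  rw [Nat.card_Icc, Nat.add_sub_cancel] at hn hm
  rw [Nat.add_sub_cancel, hn, Finset.sum_Icc_succ_top (by omega), ← add_assoc, hm, mul_add_one,
    Finset.mul_sum]
  congr 1
  refine Finset.sum_congr rfl fun i hi => ?_
  rw [← pow_add, Nat.add_sub_cancel' (le_of_descending hd hq (Finset.mem_Icc.1 hi))]

end DescendingExponents

end HitProblem

theorem theorem1p3_general {q d m n : ℕ} (hq : 0 < q) (hd : q ≤ d) (hm : 0 < m)
    (hweight : q ≤ HitProblem.binaryWeight (m + q - 1) + 1) (hn : n + q = 2 ^ d * (m + q)) :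
    Module.finrank (ZMod 2) (QPdeg (q + 1) n) =
      (2 ^ (q + 1) - 1) * Module.finrank (ZMod 2) (QPdeg q m) := by
  obtain rfl : n = HitProblem.liftDegree q m d :=
    Nat.add_right_cancel (hn.trans (HitProblem.liftDegree_add q m d).symm)
  exact (HitProblem.sparseHitTower_of_le_binaryWeight hweight).finrank_QPdeg_liftDegree hq hd hm

theorem theorem1p3 (k : ℕ) (d : ℕ → ℕ) (n m : ℕ)
    (hd_pos : ∀ i ∈ Finset.Icc 1 (k - 1), 0 < d i)
    (hd_strict : ∀ i, 1 ≤ i → i < k - 2 → d (i + 1) < d i)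
    (hd_last : d (k - 1) ≤ d (k - 2))
    (hn : n = ∑ i ∈ Finset.Icc 1 (k - 1), (2 ^ d i - 1))
    (hm : m = ∑ i ∈ Finset.Icc 1 (k - 2), (2 ^ (d i - d (k - 1)) - 1))
    (hk : 3 ≤ k - 1) (hdk : k - 1 ≤ d (k - 1)) :
    Module.finrank (ZMod 2) (QPdeg k n) =
      (2 ^ k - 1) * Module.finrank (ZMod 2) (QPdeg (k - 1) m) := by
  obtain ⟨q, rfl⟩ : ∃ q, k = q + 1 := ⟨k - 1, by omega⟩
  have hq : 0 < q := by omega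
  rw [hn, hm]
  exact theorem1p3_general hq hdk
    (HitProblem.sum_two_pow_sub_one_pos_of_descending hd_strict hd_last hk)
    (Nat.sub_le_iff_le_add.1
      (HitProblem.binaryWeight_sum_of_descending hd_strict hd_last hq).ge)
    (HitProblem.sum_two_pow_sub_one_add_of_descending hd_strict hd_last hq)
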